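/- Let $B(0,R)=\{y\in\mathbb R^3:|y|\le R\}$. For $f:\mathbb R^3\to\mathbb C$ put $\hat f(\xi)=\int_{\mathbb R^3}e^{-ix\cdot\xi}f(x)\,dx$, and for $t>0$ let $\frac{\sin(t|\nabla|)}{|\nabla|}f$ and $\cos(t|\nabla|)f$ be the functions $$\frac{1}{(2\pi)^3}\int_{\mathbb R^3}e^{ix\cdot\xi}\,\frac{\sin(t|\xi|)}{|\xi|}\,\hat f(\xi)\,d\xi\qquad\text{and}\qquad \frac{1}{(2\pi)^3}\int_{\mathbb R^3}e^{ix\cdot\xi}\cos(t|\xi|)\,\hat f(\xi)\,d\xi .$$ Let $\|f\|_{H^4(B(0,R))}=\big(\sum_{|\alpha|\le 4}\|\partial^\alpha f\|_{L^2(B(0,R))}^2\big)^{1/2}$, with weak derivatives taken in the interior of $B(0,R)$. There is an absolute constant $C$ such that for all $R>0$, all $t>0$ and all $f\in H^4(\mathbb R^3)$ with $\operatorname{supp} f\subseteq B(0,R)$, the functions $f$ and $\hat f$ are integrable (so that the integrals above converge absolutely) and $$\Big\|\frac{\sin(t|\nabla|)}{|\nabla|}f\Big\|_{L^\infty(\mathbb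 R^3)}\le C\min\{1,(1+t)^{-1}R\}\,\|f\|_{H^4(B(0,R))},$$ $$\|\cos(t|\nabla|)f\|_{L^\infty(\mathbb R^3)}\le C\min\{1,(1+t)^{-1}R\}\,\|f\|_{H^4(B(0,R))}.$$ -/

import Mathlib

open MeasureTheory
open scoped ENNReal FourierTransform

noncomputable section

namespace Wave3D

/-- Three-dimensional Euclidean space. -/
abbrev E3 : Type := EuclideanSpace ℝ (Fin 3)

/-- The classical partial derivative in the `i`-th coordinate direction. -/
def partialDeriv (i : Fin 3) (φ : E3 → ℂ) : E3 → ℂ :=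
  fun x => fderiv ℝ φ x (EuclideanSpace.single i 1)

/-- The classical derivative `∂₁^{α₁} ∂₂^{α₂} ∂₃^{α₃} φ`. -/
def multiDeriv (α : Fin 3 → ℕ) (φ : E3 → ℂ) : E3 → ℂ :=
  (partialDeriv 0)^[α 0] ((partialDeriv 1)^[α 1] ((partialDeriv 2)^[α 2] φ))

/-- On the open set `Ω`, the locally integrable function `g` is the weak derivative `∂^α f`. -/
def HasWeakDeriv (Ω : Set E3) (α : Fin 3 → ℕ) (f g : E3 → ℂ) : Prop :=
  LocallyIntegrableOn f Ω ∧ LocallyIntegrableOn g Ω ∧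
    ∀ φ : E3 → ℂ, ContDiff ℝ (⊤ : ℕ∞) φ → HasCompactSupport φ → tsupport φ ⊆ Ω →
      ∫ x in Ω, f x * multiDeriv α φ x = (-1) ^ (∑ i, α i) * ∫ x in Ω, g x * φ x

/-- The multi-indices of order at most `k`. -/
def multiIndices (k : ℕ) : Finset (Fin 3 → ℕ) :=
  (Fintype.piFinset fun _ : Fin 3 => Finset.range (k + 1)).filter fun α => ∑ i, α i ≤ k

/-- The `H^k(Ω)` norm `(∑_{|α| ≤ k} ‖∂^α f‖_{L²(Ω)}²)^{1/2}` on an open set `Ω`. Weak derivatives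
are unique almost everywhere on `Ω`, so that the infimum runs over a single value if all of them
exist; otherwise it is `∞`. -/
def sobolevNorm (k : ℕ) (Ω : Set E3) (f : E3 → ℂ) : ℝ≥0∞ :=
  ⨅ (g : (Fin 3 → ℕ) → E3 → ℂ) (_ : ∀ α ∈ multiIndices k, HasWeakDeriv Ω α f (g α)),
    (∑ α ∈ multiIndices k, eLpNorm (g α) 2 (volume.restrict Ω) ^ 2) ^ (1 / 2 : ℝ)

/-- `f ∈ H^k(ℝ³)`. -/
def MemH (k : ℕ) (f : E3 → ℂ) : Prop :=
  sobolevNorm k Set.univ f < ∞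

/-- The operator `m(|∇|)`. The Fourier transform `𝓕` is the one with kernel `e^{-2πi x·ξ}`, for
which `|∇|` is multiplication by `2π|ξ|`. -/
def radialMultiplier (m : ℝ → ℝ) (f : E3 → ℂ) : E3 → ℂ :=
  𝓕⁻ (fun ξ : E3 => (m (2 * Real.pi * ‖ξ‖) : ℂ) * 𝓕 f ξ)

/-- `sin(t|∇|)/|∇| f`. The value of the symbol at the single frequency `0` is immaterial. -/
def waveSin (t : ℝ) (f : E3 → ℂ) : E3 → ℂ :=
  radialMultiplier (fun r => Real.sin (t * r) / r) f

/-- `cos(t|∇|) f`. -/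
def waveCos (t : ℝ) (f : E3 → ℂ) : E3 → ℂ :=
  radialMultiplier (fun r => Real.cos (t * r)) f

end Wave3D

end

noncomputable section

namespace Wave3D

open Metric Real Topology Filter

/-! For smooth data and $t\ge 1$ the estimate for the sine operator is Kirchhoff's formula: $4\pi
t\,\frac{\sin(t|\nabla|)}{|\nabla|}f(x)$ is the integral of $f$ over the sphere of radius $t$ about
$x$. Cauchy–Schwarz on the sphere bounds it by the $L^2$ norm of $f$ there, which a trace inequality
controls by the $H^1$ norm, times the square root of the area that meets the support, which is
$O(\min(R,t)^2)$. Dividing by $t$ leaves $\min(1,R/t)$ (`exists_norm_waveSin_le_of_one_le`). Surface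
measure is avoided: a sphere integral is the derivative in the radius of ball integrals.

The cosine operator is the time derivative of the sine operator, and the second time derivative is
the sine operator applied to $\Delta f$. Interpolating over $[t,t+1]$ bounds the first derivative by
the function and the second derivative (`norm_deriv_le_of_norm_second_deriv_le`); this costs three
derivatives of $f$.

For $t\le 1$ both functions are at most $\int|\hat f|$, and a bound by $\min(1,R)$ is needed. The
$1$ comes from Plancherel and the integrability of $(1+|\xi|^2)^{-2}$. The $R$ comes from the
pointwise decay $|\hat f|\lesssim (R+R^2)(1+|\xi|^2)^{-2}$; this uses four derivatives, because
their $L^1$ norms are small when the support is small.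

General data are mollified (`exists_weak_bound`): $L^2$ norms of weak derivatives do not grow,
supports grow by a vanishing amount, and the multipliers converge by dominated convergence. Weak
derivatives vanish off the closed ball and the sphere is null, so the norm on the ball controls the
global one (`le_sobolevNorm_ball`). -/

/-! ### Fourier transform of the indicator of a ball -/

theorem volume_real_disc (s y : ℝ) :
    volume.real {w : Fin 2 → ℝ | y ^ 2 + (w 0 ^ 2 + w 1 ^ 2) < s ^ 2} = π * max 0 (s ^ 2 - y ^ 2) := by
  have key : volume {w : Fin 2 → ℝ | y ^ 2 + (w 0 ^ 2 + w 1 ^ 2) < s ^ 2}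
      = volume (ball (0 : EuclideanSpace ℝ (Fin 2)) √(s ^ 2 - y ^ 2)) := by
    rw [← (PiLp.volume_preserving_toLp (Fin 2)).measure_preimage measurableSet_ball.nullMeasurableSet]
    congr 1
    ext w
    simp only [Set.mem_ofPred_eq, Set.mem_preimage, mem_ball_zero_iff, EuclideanSpace.norm_eq,
      Fin.sum_univ_two, Real.norm_eq_abs, sq_abs]
    rw [Real.sqrt_lt_sqrt_iff (by positivity)]
    constructor <;> intro h <;> linarith
  rw [measureReal_def, key, EuclideanSpace.volume_ball_fin_two]
  rcases le_total 0 (s ^ 2 - y ^ 2) with h | h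
  · rw [max_eq_right h, ← ENNReal.ofReal_pow (sqrt_nonneg _), sq_sqrt h]
    simp [ENNReal.toReal_ofReal h, mul_comm, pi_nonneg]
  · rw [max_eq_left h, sqrt_eq_zero_of_nonpos h]
    simp

/-- The slice of the ball at height $y$ is a disc of area $\pi(s^2-y^2)$. -/
theorem setIntegral_ball_coord {G : ℝ → ℂ} (hG : Continuous G) {s : ℝ} (hs : 0 < s) :
    ∫ z in ball (0 : E3) s, G (z 0) = π * ∫ y in -s..s, ((s : ℂ) ^ 2 - (y : ℂ) ^ 2) * G y := by
  have h1 : ∫ z in ball (0 : E3) s, G (z 0) =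
      ∫ w in {w : Fin 3 → ℝ | w 0 ^ 2 + (w 1 ^ 2 + w 2 ^ 2) < s ^ 2}, G (w 0) := by
    rw [← (PiLp.volume_preserving_toLp (Fin 3)).setIntegral_preimage_emb
      (MeasurableEquiv.toLp 2 (Fin 3 → ℝ)).measurableEmbedding]
    congr 2
    ext w
    simp only [Set.mem_ofPred_eq, Set.mem_preimage, mem_ball_zero_iff, EuclideanSpace.norm_eq,
      Fin.sum_univ_three, Real.norm_eq_abs, sq_abs]
    rw [Real.sqrt_lt' hs, add_assoc]
  let D : Set (ℝ × (Fin 2 → ℝ)) := {p | p.1 ^ 2 + (p.2 0 ^ 2 + p.2 1 ^ 2) < s ^ 2}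
  have hDm : MeasurableSet D := by
    apply measurableSet_lt <;> fun_prop
  have h2 : ∫ w in {w : Fin 3 → ℝ | w 0 ^ 2 + (w 1 ^ 2 + w 2 ^ 2) < s ^ 2}, G (w 0) =
      ∫ p in D, G p.1 := by
    rw [← (volume_preserving_piFinSuccAbove (fun _ : Fin 3 => ℝ) 0).setIntegral_preimage_emb
      (MeasurableEquiv.piFinSuccAbove (fun _ : Fin 3 => ℝ) 0).measurableEmbedding]
    rfl
  have hDfin : volume D < ∞ := by
    have hsub : D ⊆ Set.Icc (-s) s ×ˢ Set.Icc (fun _ => -s) (fun _ => s) := by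
      rintro ⟨y, w⟩ h
      have h : y ^ 2 + (w 0 ^ 2 + w 1 ^ 2) < s ^ 2 := h
      have e0 : |y| ≤ s := abs_le_of_sq_le_sq (by nlinarith [sq_nonneg (w 0), sq_nonneg (w 1)]) hs.le
      have e1 : |w 0| ≤ s := abs_le_of_sq_le_sq (by nlinarith [sq_nonneg y, sq_nonneg (w 1)]) hs.le
      have e2 : |w 1| ≤ s := abs_le_of_sq_le_sq (by nlinarith [sq_nonneg (w 0), sq_nonneg y]) hs.le
      rw [abs_le] at e0 e1 e2
      refine ⟨e0, fun i => ?_, fun i => ?_⟩ <;> fin_cases i <;> simp [e1, e2]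
    exact (measure_mono hsub).trans_lt (isCompact_Icc.prod isCompact_Icc).measure_lt_top
  obtain ⟨K, hK⟩ := (isCompact_Icc (a := -s) (b := s)).exists_bound_of_continuousOn hG.continuousOn
  have hInt : IntegrableOn (fun p : ℝ × (Fin 2 → ℝ) => G p.1) D := by
    refine Measure.integrableOn_of_bounded hDfin.ne (by fun_prop) (M := K) ?_
    filter_upwards [ae_restrict_mem hDm] with p hp
    have hp : p.1 ^ 2 + (p.2 0 ^ 2 + p.2 1 ^ 2) < s ^ 2 := hp
    exact hK _ (abs_le.1 (abs_le_of_sq_le_sq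
      (by nlinarith [sq_nonneg (p.2 0), sq_nonneg (p.2 1)]) hs.le))
  have h3 : ∫ p in D, G p.1 = ∫ y, (π * max 0 (s ^ 2 - y ^ 2) : ℝ) * G y := by
    rw [← integral_indicator hDm, Measure.volume_eq_prod, integral_prod]
    · congr 1
      ext y
      have : ∀ w, D.indicator (fun p : ℝ × (Fin 2 → ℝ) => G p.1) (y, w) =
          ({w : Fin 2 → ℝ | y ^ 2 + (w 0 ^ 2 + w 1 ^ 2) < s ^ 2}).indicator (fun _ => G y) w := by
        intro w
        rfl
      simp_rw [this]
      rw [integral_indicator_const, volume_real_disc, Complex.real_smul]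
      apply measurableSet_lt <;> fun_prop
    · rw [← Measure.volume_eq_prod]
      exact (integrable_indicator_iff hDm).2 hInt
  rw [h1, h2, h3, intervalIntegral.integral_of_le (by linarith), ← integral_Icc_eq_integral_Ioc,
    ← integral_const_mul, ← integral_indicator measurableSet_Icc]
  congr 1
  ext y
  by_cases hy : y ∈ Set.Icc (-s) s
  · rw [Set.indicator_of_mem hy, max_eq_right (by nlinarith [hy.1, hy.2])]
    push_cast
    ring
  · rw [Set.indicator_of_notMem hy, max_eq_left]
    · simp
    · by_contra! h
      exact hy (abs_le.1 (abs_le_of_sq_le_sq (by linarith) hs.le))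

/-- The Fourier transform of the indicator function of a ball, by slicing. -/
theorem setIntegral_ball_character (ξ : E3) {s : ℝ} (hs : 0 < s) :
    ∫ z in ball (0 : E3) s, Complex.exp (↑(2 * π * inner ℝ ξ z) * Complex.I) =
      π * ∫ y in -s..s, ((s : ℂ) ^ 2 - (y : ℂ) ^ 2) *
        Complex.exp (↑(2 * π * ‖ξ‖ * y) * Complex.I) := by
  rw [← setIntegral_ball_coord (G := fun y => Complex.exp (↑(2 * π * ‖ξ‖ * y) * Complex.I))
    (by fun_prop) hs]
  -- The ball is invariant under rotations, so $\xi$ may be turned onto the first axis.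
  have hb : ∃ b : OrthonormalBasis (Fin 3) ℝ E3, ξ = ‖ξ‖ • b 0 := by
    by_cases hξ : ξ = 0
    · exact ⟨EuclideanSpace.basisFun _ _, by simp [hξ]⟩
    · obtain ⟨b, hb⟩ := Orthonormal.exists_orthonormalBasis_extension_of_card_eq (𝕜 := ℝ)
        (E := E3) (ι := Fin 3) (by simp) (v := fun _ => ‖ξ‖⁻¹ • ξ) (s := {0}) (by
          constructor
          · rintro ⟨i, hi⟩
            simp [norm_smul, hξ]
          · rintro ⟨i, hi⟩ ⟨j, hj⟩ hij
            simp at hi hj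
            subst hi hj
            exact absurd rfl hij)
      refine ⟨b, ?_⟩
      rw [hb 0 rfl, smul_smul, mul_inv_cancel₀ (norm_ne_zero_iff.2 hξ), one_smul]
  obtain ⟨b, hb⟩ := hb
  rw [← (b.repr.measurePreserving).setIntegral_preimage_emb
    b.repr.toHomeomorph.measurableEmbedding
    (fun z => Complex.exp (↑(2 * π * ‖ξ‖ * z 0) * Complex.I))]
  have hpre : b.repr ⁻¹' ball 0 s = ball 0 s := by
    ext z
    simp
  rw [hpre]
  congr 1
  ext z
  congr 3
  conv_lhs => rw [hb]
  rw [inner_smul_left, b.repr_apply_apply]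
  simp
  ring

/-- The transform of the indicator of a ball has radial derivative the transform of the sphere. -/
theorem hasDerivAt_setIntegral_ball_character {ξ : E3} (hξ : ξ ≠ 0) {s : ℝ} (hs : 0 < s) :
    HasDerivAt (fun s : ℝ => ∫ z in ball (0 : E3) s,
        Complex.exp (↑(2 * π * inner ℝ ξ z) * Complex.I))
      (4 * π * s * ↑(Real.sin (s * (2 * π * ‖ξ‖)) / (2 * π * ‖ξ‖))) s := by
  set k := 2 * π * ‖ξ‖ with hk
  have hk0 : 0 < k := by have := norm_pos_iff.2 hξ; positivity
  have hder : ∀ {G : ℝ → ℂ}, Continuous G →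
      HasDerivAt (fun s : ℝ => ∫ y in -s..s, G y) (G s + G (-s)) s := by
    intro G hG
    have h1 : HasDerivAt (fun s : ℝ => ∫ y in (0 : ℝ)..s, G y) (G s) s :=
      intervalIntegral.integral_hasDerivAt_right (hG.intervalIntegrable _ _)
        (hG.stronglyMeasurableAtFilter _ _) hG.continuousAt
    have h2 : HasDerivAt (fun s : ℝ => ∫ y in (0 : ℝ)..s, G y) (G (-s)) (-s) :=
      intervalIntegral.integral_hasDerivAt_right (hG.intervalIntegrable _ _)
        (hG.stronglyMeasurableAtFilter _ _) hG.continuousAt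
    have h3 := h1.sub (h2.scomp s (hasDerivAt_neg s))
    refine (h3.congr_of_eventuallyEq (.of_forall fun u => ?_)).congr_deriv (by simp)
    simp only [Pi.sub_apply, Function.comp]
    rw [intervalIntegral.integral_interval_sub_left (hG.intervalIntegrable _ _)
      (hG.intervalIntegrable _ _)]
  have hE : Continuous fun y : ℝ => Complex.exp (↑(k * y) * Complex.I) := by fun_prop
  have hE2 : Continuous fun y : ℝ => (y : ℂ) ^ 2 * Complex.exp (↑(k * y) * Complex.I) := by fun_prop
  have hsq : HasDerivAt (fun s : ℝ => (s : ℂ) ^ 2) (2 * s) s := by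
    have := (Complex.ofRealCLM.hasDerivAt (x := s)).pow 2
    refine (this.congr_of_eventuallyEq (.of_forall fun u => ?_)).congr_deriv (by simp)
    simp
  -- The boundary terms of the two pieces cancel since $s^2-y^2$ vanishes at $y=\pm s$; only
  -- $2s\int_{-s}^{s}e^{iky}\,dy$ survives.
  have hmain := (((hsq.mul (hder hE)).sub (hder hE2)).const_mul (π : ℂ))
  refine (hmain.congr_of_eventuallyEq ?_).congr_deriv ?_
  · filter_upwards [lt_mem_nhds hs] with u hu
    rw [setIntegral_ball_character ξ hu]
    simp only [Pi.sub_apply, Pi.mul_apply]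
    rw [← intervalIntegral.integral_const_mul (u ^ 2 : ℂ), ← intervalIntegral.integral_sub]
    · congr 2
      ext y
      ring
    · exact (continuous_const.mul hE).intervalIntegrable _ _
    · exact hE2.intervalIntegrable _ _
  · have hInt : ∫ y in -s..s, Complex.exp (↑(k * y) * Complex.I) = ↑(2 * Real.sin (s * k) / k) := by
      have := integral_exp_mul_complex (a := -s) (b := s) (c := (k : ℂ) * Complex.I)
        (by simp [hk0.ne'])
      have e : ∀ y : ℝ, Complex.exp (↑(k * y) * Complex.I) = Complex.exp (k * Complex.I * y) := by
        intro y; congr 1; push_cast; ring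
      simp_rw [e]
      rw [this]
      have hk' : (k : ℂ) ≠ 0 := by exact_mod_cast hk0.ne'
      push_cast
      rw [Complex.sin]
      have e1 : (k : ℂ) * Complex.I * -s = -(s * k) * Complex.I := by ring
      have e2 : (k : ℂ) * Complex.I * s = (s * k) * Complex.I := by ring
      rw [e1, e2]
      field_simp
      rw [Complex.I_sq]
      ring
    rw [hInt]
    push_cast
    ring

/-! ### Kirchhoff's formula -/

theorem radialMultiplier_apply (m : ℝ → ℝ) (f : E3 → ℂ) (x : E3) :
    radialMultiplier m f x = ∫ ξ, Complex.exp (↑(2 * π * inner ℝ ξ x) * Complex.I) *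
      ((m (2 * π * ‖ξ‖) : ℂ) * 𝓕 f ξ) := by
  rw [radialMultiplier, Real.fourierInv_eq']
  rfl

theorem setIntegral_ball_eq_translate {V : Type*} [NormedAddCommGroup V] [NormedSpace ℝ V]
    (F : E3 → V) (x : E3) (u : ℝ) :
    ∫ y in ball x u, F y = ∫ z in ball (0 : E3) u, F (x + z) := by
  rw [← (measurePreserving_add_left volume x).setIntegral_preimage_emb
    (measurableEmbedding_addLeft x)]
  congr 2
  ext z
  simp [dist_eq_norm]

theorem setIntegral_ball_eq_scale {V : Type*} [NormedAddCommGroup V] [NormedSpace ℝ V]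
    (F : E3 → V) (x : E3) {u : ℝ} (hu : 0 < u) :
    ∫ y in ball x u, F y = u ^ 3 • ∫ z in ball (0 : E3) 1, F (x + u • z) := by
  rw [Measure.setIntegral_comp_smul_of_pos volume (fun z => F (x + z)) _ hu,
    smul_unitBall_of_pos hu, setIntegral_ball_eq_translate]
  simp [smul_smul, hu.ne']

theorem norm_character (a : ℝ) : ‖Complex.exp (↑a * Complex.I)‖ = 1 :=
  Complex.norm_exp_ofReal_mul_I a

theorem abs_sin_mul_div_le {u : ℝ} (hu : 0 ≤ u) (k : ℝ) : |Real.sin (u * k) / k| ≤ u := by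
  rw [abs_div]
  apply div_le_of_le_mul₀ (abs_nonneg _) hu
  calc |Real.sin (u * k)| ≤ |u * k| := Real.abs_sin_le_abs
    _ = u * |k| := by rw [abs_mul, abs_of_nonneg hu]

/-- The Kirchhoff formula, with the spherical integral written as a derivative of ball integrals. -/
theorem hasDerivAt_setIntegral_ball_of_fourier {f : E3 → ℂ} (hc : Continuous f)
    (hf : Integrable f) (hf' : Integrable (𝓕 f)) (x : E3) {s : ℝ} (hs : 0 < s) :
    HasDerivAt (fun s : ℝ => ∫ y in ball x s, f y) (4 * π * s * waveSin s f x) s := by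
  let e : E3 → E3 → ℂ := fun ξ z => Complex.exp (↑(2 * π * inner ℝ ξ z) * Complex.I)
  have hprod : ∀ u : ℝ, Integrable (Function.uncurry fun (z ξ : E3) => e ξ z * (e ξ x * 𝓕 f ξ))
      ((volume.restrict (ball (0 : E3) u)).prod volume) := by
    intro u
    have hfin : IsFiniteMeasure (volume.restrict (ball (0 : E3) u)) :=
      ⟨by rw [Measure.restrict_apply_univ]; exact measure_ball_lt_top⟩
    have h1 : Integrable (fun p : E3 × E3 => 𝓕 f p.2)
        ((volume.restrict (ball (0 : E3) u)).prod volume) := hf'.comp_snd _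
    refine h1.mono ?_ (.of_forall fun p => ?_)
    · have : Continuous fun p : E3 × E3 => e p.2 p.1 * e p.2 x := by fun_prop
      refine (this.aestronglyMeasurable.mul h1.aestronglyMeasurable).congr (.of_forall fun p => ?_)
      simp [Function.uncurry, mul_assoc]
    · simp only [Function.uncurry, norm_mul, e, norm_character, one_mul, le_refl]
  -- Fourier inversion and Fubini move the dependence on the radius into the transform of the
  -- indicator of the ball.
  have hrep : ∀ u : ℝ, ∫ y in ball x u, f y =
      ∫ ξ, (∫ z in ball (0 : E3) u, e ξ z) * (e ξ x * 𝓕 f ξ) := by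
    intro u
    rw [setIntegral_ball_eq_translate]
    have h1 : ∀ z, f (x + z) = ∫ ξ, e ξ z * (e ξ x * 𝓕 f ξ) := by
      intro z
      rw [← congrFun (hc.fourierInv_fourier_eq hf hf') (x + z), Real.fourierInv_eq']
      congr 1
      ext ξ
      simp only [e, smul_eq_mul, ← mul_assoc, ← Complex.exp_add, inner_add_right]
      congr 2
      push_cast
      ring
    simp_rw [h1]
    rw [integral_integral_swap (hprod u)]
    simp_rw [integral_mul_const]
  have hFint : ∀ u : ℝ, Integrable fun ξ => (∫ z in ball (0 : E3) u, e ξ z) * (e ξ x * 𝓕 f ξ) := by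
    intro u
    have := (hprod u).integral_prod_right
    simpa only [Function.uncurry, integral_mul_const] using this
  have hne : ∀ᵐ ξ : E3, ξ ≠ 0 := by simp [ae_iff]
  -- For $0<u<2s$ both $u$ and $|\sin(uk)/k|\le u$ are below $2s$, whence the majorant.
  have hmain := hasDerivAt_integral_of_dominated_loc_of_deriv_le (𝕜 := ℝ) (μ := (volume : Measure E3))
    (s := Set.Ioo 0 (2 * s)) (x₀ := s)
    (F := fun u ξ => (∫ z in ball (0 : E3) u, e ξ z) * (e ξ x * 𝓕 f ξ))
    (F' := fun u ξ => (4 * π * u * ↑(Real.sin (u * (2 * π * ‖ξ‖)) / (2 * π * ‖ξ‖)))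
      * (e ξ x * 𝓕 f ξ))
    (bound := fun ξ => (4 * π * (2 * s) * (2 * s)) * ‖𝓕 f ξ‖)
    (Ioo_mem_nhds hs (by linarith)) (.of_forall fun u => (hFint u).aestronglyMeasurable) (hFint s)
    ?_ ?_ (hf'.norm.const_mul _) ?_
  · have hd := hmain.2
    simp_rw [hrep]
    refine hd.congr_deriv ?_
    rw [waveSin, radialMultiplier_apply, ← integral_const_mul]
    congr 1
    ext ξ
    simp only [e]
    ring
  · refine AEStronglyMeasurable.mul ?_ (AEStronglyMeasurable.mul ?_ hf'.aestronglyMeasurable)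
    · exact Measurable.aestronglyMeasurable (by fun_prop)
    · exact Continuous.aestronglyMeasurable (by fun_prop)
  · refine .of_forall fun ξ u hu => ?_
    simp only [norm_mul, e, norm_character, one_mul, Complex.norm_real, norm_eq_abs]
    have h1 := abs_sin_mul_div_le hu.1.le (2 * π * ‖ξ‖)
    rw [abs_of_pos hu.1, abs_of_pos pi_pos]
    have h4 : ‖(4 : ℂ)‖ = 4 := by norm_num
    rw [h4]
    have := hu.1
    have := hu.2
    gcongr
    linarith
  · filter_upwards [hne] with ξ hξ u hu
    exact (hasDerivAt_setIntegral_ball_character hξ hu.1).mul_const _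

/-! ### Trace inequality -/

/-- The derivative of ball integrals of a `C¹` function with respect to the radius. -/
theorem hasDerivAt_setIntegral_ball {F : E3 → ℝ} (hF : ContDiff ℝ 1 F) {K : ℝ}
    (hK : ∀ y, ‖fderiv ℝ F y‖ ≤ K) (x : E3) {s : ℝ} (hs : 0 < s) :
    HasDerivAt (fun s : ℝ => ∫ y in ball x s, F y)
      (3 * s ^ 2 * (∫ z in ball (0 : E3) 1, F (x + s • z)) +
        s ^ 3 * ∫ z in ball (0 : E3) 1, fderiv ℝ F (x + s • z) z) s := by
  have hdF : Continuous (fderiv ℝ F) := hF.continuous_fderiv (by norm_num)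
  have hFc : Continuous F := hF.continuous
  have hfin : IsFiniteMeasure (volume.restrict (ball (0 : E3) 1)) :=
    ⟨by rw [Measure.restrict_apply_univ]; exact measure_ball_lt_top⟩
  have hcont : ∀ G : E3 → ℝ, Continuous G → IntegrableOn G (ball (0 : E3) 1) := fun G hG =>
    (hG.continuousOn.integrableOn_compact (isCompact_closedBall (0 : E3) 1)).mono_set
      ball_subset_closedBall
  -- After rescaling to the unit ball the radius occurs only in the integrand, so one may
  -- differentiate under the integral.
  have hmain := hasDerivAt_integral_of_dominated_loc_of_deriv_le (𝕜 := ℝ)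
    (μ := volume.restrict (ball (0 : E3) 1)) (s := Set.univ) (x₀ := s)
    (F := fun u z => F (x + u • z)) (F' := fun u z => fderiv ℝ F (x + u • z) z)
    (bound := fun _ => K) univ_mem
    (.of_forall fun u => Continuous.aestronglyMeasurable (by fun_prop))
    (hcont _ (by fun_prop)) (Continuous.aestronglyMeasurable (by fun_prop)) ?_
    (integrable_const _) ?_
  · have h3 : HasDerivAt (fun s : ℝ => s ^ 3) (3 * s ^ 2) s := by
      simpa using hasDerivAt_pow 3 s
    refine (h3.mul hmain.2).congr_of_eventuallyEq ?_
    filter_upwards [lt_mem_nhds hs] with u hu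
    simp [setIntegral_ball_eq_scale F x hu]
  · filter_upwards [ae_restrict_mem measurableSet_ball] with z hz u _
    have hz : ‖z‖ < 1 := by simpa using hz
    calc ‖fderiv ℝ F (x + u • z) z‖ ≤ ‖fderiv ℝ F (x + u • z)‖ * ‖z‖ :=
          ContinuousLinearMap.le_opNorm _ _
      _ ≤ ‖fderiv ℝ F (x + u • z)‖ * 1 := by gcongr
      _ ≤ K := by rw [mul_one]; exact hK _
  · refine .of_forall fun z u _ => ?_
    have h1 : HasDerivAt (fun u : ℝ => x + u • z) z u := by
      simpa using ((hasDerivAt_id u).smul_const z).const_add x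
    exact ((hF.differentiable (by norm_num) (x + u • z)).hasFDerivAt.comp_hasDerivAt u h1)

theorem setIntegral_unitBall_scale_le {G : E3 → ℝ} (hG : Integrable G) (h0 : ∀ y, 0 ≤ G y)
    (x : E3) {s : ℝ} (hs : 0 < s) :
    s ^ 3 * ∫ z in ball (0 : E3) 1, G (x + s • z) ≤ ∫ y, G y := by
  have := setIntegral_ball_eq_scale G x hs
  rw [smul_eq_mul] at this
  rw [← this]
  exact setIntegral_le_integral hG (.of_forall h0)

/-- A trace inequality: the integral over a sphere is controlled by the `W^{1,1}` norm. -/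
theorem exists_hasDerivAt_setIntegral_ball_le {F : E3 → ℝ} (hF : ContDiff ℝ 1 F)
    (hc : HasCompactSupport F) (x : E3) {s : ℝ} (hs : 0 < s) :
    ∃ p, HasDerivAt (fun s : ℝ => ∫ y in ball x s, F y) p s ∧
      p ≤ 3 / s * (∫ y, |F y|) + ∫ y, ‖fderiv ℝ F y‖ := by
  have hdF : Continuous (fderiv ℝ F) := hF.continuous_fderiv (by norm_num)
  have hdc : HasCompactSupport (fderiv ℝ F) := hc.fderiv ℝ
  obtain ⟨K, hK⟩ := hdF.bounded_above_of_compact_support hdc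
  have hcont : ∀ G : E3 → ℝ, Continuous G → IntegrableOn G (ball (0 : E3) 1) := fun G hG =>
    (hG.continuousOn.integrableOn_compact (isCompact_closedBall (0 : E3) 1)).mono_set
      ball_subset_closedBall
  have hFc : Continuous F := hF.continuous
  refine ⟨_, hasDerivAt_setIntegral_ball hF hK x hs, ?_⟩
  apply add_le_add
  · have h1 := setIntegral_unitBall_scale_le (hFc.integrable_of_hasCompactSupport hc).abs
      (fun y => abs_nonneg _) x hs
    have h2 : ∫ z in ball (0 : E3) 1, F (x + s • z) ≤ ∫ z in ball (0 : E3) 1, |F (x + s • z)| :=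
      integral_mono (hcont _ (by fun_prop)) (hcont _ (by fun_prop)) fun z => le_abs_self _
    calc 3 * s ^ 2 * ∫ z in ball (0 : E3) 1, F (x + s • z)
        ≤ 3 * s ^ 2 * ∫ z in ball (0 : E3) 1, |F (x + s • z)| := by gcongr
      _ = 3 / s * (s ^ 3 * ∫ z in ball (0 : E3) 1, |F (x + s • z)|) := by field_simp
      _ ≤ _ := by gcongr
  · have h1 := setIntegral_unitBall_scale_le (hdF.integrable_of_hasCompactSupport hdc).norm
      (fun y => norm_nonneg _) x hs
    refine le_trans ?_ h1
    gcongr 1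
    refine setIntegral_mono_on (hcont _ (by fun_prop)) (hcont _ (by fun_prop)) measurableSet_ball ?_
    intro z hz
    have hz : ‖z‖ < 1 := by simpa using hz
    calc fderiv ℝ F (x + s • z) z ≤ ‖fderiv ℝ F (x + s • z)‖ * ‖z‖ :=
          (Real.le_norm_self _).trans (ContinuousLinearMap.le_opNorm _ _)
      _ ≤ ‖fderiv ℝ F (x + s • z)‖ * 1 := by gcongr
      _ = _ := mul_one _

/-! ### Cauchy–Schwarz on spheres -/

/-- An inequality between integrals over thin shells $s\le|y-x|<u$ passes to right difference
quotients, hence to the derivatives that stand for sphere integrals. -/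
theorem norm_deriv_le_of_norm_sub_le {V : Type*} [NormedAddCommGroup V] [NormedSpace ℝ V]
    {I : ℝ → V} {K : ℝ → ℝ} {a : V} {b s : ℝ} (hI : HasDerivAt I a s) (hK : HasDerivAt K b s)
    (h : ∀ u, s < u → ‖I u - I s‖ ≤ K u - K s) : ‖a‖ ≤ b := by
  have h1 := (hasDerivAt_iff_tendsto_slope.1 hI).mono_left (nhdsGT_le_nhdsNE s)
  have h2 := (hasDerivAt_iff_tendsto_slope.1 hK).mono_left (nhdsGT_le_nhdsNE s)
  refine le_of_tendsto_of_tendsto h1.norm h2 ?_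
  filter_upwards [self_mem_nhdsWithin] with u hu
  have hu : 0 < u - s := sub_pos.2 hu
  rw [slope_def_module, slope_def_field, norm_smul, norm_inv, norm_eq_abs, abs_of_pos hu,
    div_eq_inv_mul]
  gcongr
  exact h u (by linarith)

/-- Cauchy-Schwarz on a sphere, in terms of radial derivatives of ball integrals. -/
theorem norm_le_of_hasDerivAt_setIntegral_ball {f : E3 → ℂ} {χ : E3 → ℝ} (hf : Continuous f)
    (hχ : Continuous χ) (h0 : ∀ y, 0 ≤ χ y) (h1 : ∀ y, f y ≠ 0 → 1 ≤ χ y) {x : E3} {s : ℝ}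
    {a : ℂ} {p q P Q : ℝ} (ha : HasDerivAt (fun s : ℝ => ∫ y in ball x s, f y) a s)
    (hp : HasDerivAt (fun s : ℝ => ∫ y in ball x s, ‖f y‖ ^ 2) p s)
    (hq : HasDerivAt (fun s : ℝ => ∫ y in ball x s, χ y) q s)
    (hP0 : 0 ≤ P) (hQ0 : 0 < Q) (hP : p ≤ P ^ 2) (hQ : q ≤ Q ^ 2) : ‖a‖ ≤ P * Q := by
  have hloc : ∀ {V : Type} [NormedAddCommGroup V] (G : E3 → V), Continuous G → ∀ u,
      IntegrableOn G (ball x u) := fun G hG u =>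
    (hG.continuousOn.integrableOn_compact (isCompact_closedBall x u)).mono_set
      ball_subset_closedBall
  -- Cauchy–Schwarz in its additive form: $2|f|\le\varepsilon|f|^2+\varepsilon^{-1}\chi$ pointwise,
  -- with $\varepsilon$ optimised afterwards.
  have key : ∀ ε : ℝ, 0 < ε → ‖a‖ ≤ 1 / 2 * (ε * p + ε⁻¹ * q) := by
    intro ε hε
    refine norm_deriv_le_of_norm_sub_le ha
      (((hp.const_mul ε).add (hq.const_mul ε⁻¹)).const_mul (1 / 2)) fun u hu => ?_
    have hsub : ball x s ⊆ ball x u := ball_subset_ball hu.le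
    simp only [Pi.add_apply]
    rw [← mul_sub, add_sub_add_comm, ← mul_sub, ← mul_sub,
      ← setIntegral_sdiff measurableSet_ball (hloc _ hf u) hsub,
      ← setIntegral_sdiff measurableSet_ball (hloc _ hχ u) hsub,
      ← setIntegral_sdiff measurableSet_ball (hloc _ (by fun_prop) u) hsub,
      ← integral_const_mul, ← integral_const_mul, ← integral_add, ← integral_const_mul]
    · refine norm_integral_le_of_norm_le ?_ (.of_forall fun y => ?_)
      · exact (hloc _ (by fun_prop) u).mono_set Set.sdiff_subset
      · by_cases hy : f y = 0
        · have := h0 y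
          simp only [hy, norm_zero]
          positivity
        · have h3 := h1 y hy
          have h4 : ε⁻¹ * 1 ≤ ε⁻¹ * χ y := by gcongr
          have h5 : 0 ≤ ε⁻¹ * (ε * ‖f y‖ - 1) ^ 2 := by positivity
          have h6 : ε⁻¹ * (ε * ‖f y‖ - 1) ^ 2 = ε * ‖f y‖ ^ 2 - 2 * ‖f y‖ + ε⁻¹ := by
            field_simp
            ring
          linarith
    · exact (hloc _ (by fun_prop) u).mono_set Set.sdiff_subset
    · exact (hloc _ (by fun_prop) u).mono_set Set.sdiff_subset
  refine le_of_forall_pos_le_add fun δ hδ => ?_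
  have hP' : 0 < P + δ / Q := by positivity
  -- The optimal $\varepsilon$ is $Q/P$; replacing $P$ by $P+\delta/Q$ allows $P=0$ and costs
  -- exactly $\delta$.
  refine (key (Q / (P + δ / Q)) (by positivity)).trans ?_
  have e1 : Q / (P + δ / Q) * p ≤ Q / (P + δ / Q) * (P + δ / Q) ^ 2 := by
    gcongr
    refine hP.trans ?_
    gcongr
    have : 0 ≤ δ / Q := by positivity
    linarith
  have e2 : (Q / (P + δ / Q))⁻¹ * q ≤ (Q / (P + δ / Q))⁻¹ * Q ^ 2 := by gcongr
  have e3 : 1 / 2 * (Q / (P + δ / Q) * (P + δ / Q) ^ 2 + (Q / (P + δ / Q))⁻¹ * Q ^ 2) =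
      P * Q + δ := by
    field_simp
    ring
  linarith

/-! ### Decay of the sine operator for $t\ge 1$ -/

theorem integrable_fourier_of_smooth {f : E3 → ℂ} (hf : ContDiff ℝ (⊤ : ℕ∞) f)
    (hc : HasCompactSupport f) : Integrable (𝓕 f) :=
  (𝓕 (hc.toSchwartzMap hf)).integrable

theorem integrable_norm_sq_of_hasCompactSupport {V : Type*} [NormedAddCommGroup V] {g : E3 → V}
    (hg : Continuous g) (hc : HasCompactSupport g) : Integrable fun y => ‖g y‖ ^ 2 := by
  have h1 : Continuous fun y => ‖g y‖ ^ 2 := by fun_prop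
  have h2 : HasCompactSupport fun y => ‖g y‖ ^ 2 :=
    hc.comp_left (g := fun v : V => ‖v‖ ^ 2) (by simp)
  exact h1.integrable_of_hasCompactSupport h2

/-- The cutoff functions `b (y / R)` have sphere integrals of size `R²`. -/
theorem exists_cutoff_sphere_bound : ∃ Q₀ : ℝ, 0 < Q₀ ∧ ∀ R s : ℝ, 0 < R → R ≤ s → ∀ x : E3,
    ∃ (χ : E3 → ℝ) (q : ℝ), Continuous χ ∧ (∀ y, 0 ≤ χ y) ∧ (∀ y, ‖y‖ ≤ R → 1 ≤ χ y) ∧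
      HasDerivAt (fun s : ℝ => ∫ y in ball x s, χ y) q s ∧ q ≤ (Q₀ * R) ^ 2 := by
  let b : ContDiffBump (0 : E3) := ⟨1, 2, by norm_num, by norm_num⟩
  set B₀ := ∫ y, |b y|
  set B₁ := ∫ y, ‖fderiv ℝ b y‖
  have hB₀ : 0 ≤ B₀ := integral_nonneg fun y => abs_nonneg _
  have hB₁ : 0 ≤ B₁ := integral_nonneg fun y => norm_nonneg _
  -- The trace inequality for the smooth cutoff replaces measuring a spherical cap. Scaling produces
  -- $\frac{3}{s}R^3B_0+R^2B_1$, and $R\le s$ makes this $O(R^2)$; the $+1$ keeps the constant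
  -- positive.
  refine ⟨√(3 * B₀ + B₁ + 1), by positivity, fun R s hR hRs x => ?_⟩
  have hs : 0 < s := hR.trans_le hRs
  have hsm : ContDiff ℝ 1 fun y : E3 => b (R⁻¹ • y) :=
    b.contDiff.comp (contDiff_const_smul _)
  have hcs : HasCompactSupport fun y : E3 => b (R⁻¹ • y) :=
    b.hasCompactSupport.comp_smul (inv_ne_zero hR.ne')
  obtain ⟨q, hq, hqle⟩ := exists_hasDerivAt_setIntegral_ball_le hsm hcs x hs
  refine ⟨_, q, hsm.continuous, fun y => b.nonneg, fun y hy => ?_, hq, hqle.trans ?_⟩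
  · refine (b.one_of_mem_closedBall ?_).ge
    rw [mem_closedBall_zero_iff, norm_smul, norm_inv, norm_eq_abs, abs_of_pos hR]
    change R⁻¹ * ‖y‖ ≤ 1
    rw [inv_mul_le_iff₀ hR]
    linarith
  · have h0 : ∫ y, |b (R⁻¹ • y)| = R ^ 3 * B₀ := by
      rw [Measure.integral_comp_smul volume (fun y => |b y|)]
      simp [abs_of_pos hR, B₀]
    have h1 : ∫ y, ‖fderiv ℝ (fun y : E3 => b (R⁻¹ • y)) y‖ = R ^ 2 * B₁ := by
      have : ∀ y, ‖fderiv ℝ (fun y : E3 => b (R⁻¹ • y)) y‖ = R⁻¹ * ‖fderiv ℝ b (R⁻¹ • y)‖ := by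
        intro y
        rw [fderiv_comp_smul, norm_smul, norm_inv, norm_eq_abs, abs_of_pos hR]
      simp_rw [this]
      rw [integral_const_mul, Measure.integral_comp_smul volume (fun y => ‖fderiv ℝ b y‖)]
      simp [abs_of_pos hR, B₁]
      field_simp
    rw [h0, h1, mul_pow, sq_sqrt (by positivity)]
    have : 3 / s * (R ^ 3 * B₀) ≤ 3 * (R ^ 2 * B₀) := by
      rw [div_mul_eq_mul_div, div_le_iff₀ hs]
      have : R ^ 2 * B₀ * R ≤ R ^ 2 * B₀ * s := by gcongr
      linarith
    nlinarith [sq_nonneg R]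

theorem norm_fderiv_norm_sq_le {h : E3 → ℂ} (hh : Differentiable ℝ h) (y : E3) :
    ‖fderiv ℝ (fun y => ‖h y‖ ^ 2) y‖ ≤ ‖h y‖ ^ 2 + ‖fderiv ℝ h y‖ ^ 2 := by
  have h1 := (hh y).hasFDerivAt.norm_sq
  rw [h1.fderiv]
  refine ContinuousLinearMap.opNorm_le_bound _ (by positivity) fun v => ?_
  have h2 : ‖(inner ℝ (h y) (fderiv ℝ h y v) : ℝ)‖ ≤ ‖h y‖ * (‖fderiv ℝ h y‖ * ‖v‖) :=
    (norm_inner_le_norm _ _).trans (by gcongr; exact ContinuousLinearMap.le_opNorm _ _)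
  have h3 : 2 * (‖h y‖ * (‖fderiv ℝ h y‖ * ‖v‖)) ≤ (‖h y‖ ^ 2 + ‖fderiv ℝ h y‖ ^ 2) * ‖v‖ := by
    have : 0 ≤ (‖h y‖ - ‖fderiv ℝ h y‖) ^ 2 * ‖v‖ := by positivity
    linarith
  refine le_trans ?_ h3
  rw [smul_apply, ContinuousLinearMap.comp_apply, innerSL_apply_apply,
    nsmul_eq_mul, norm_mul]
  rw [Nat.cast_ofNat, Real.norm_ofNat]
  gcongr

/-- The decay estimate for `sin(t|∇|)/|∇|` and times bounded below, in terms of the `H¹` norm. -/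
theorem exists_norm_waveSin_le_of_one_le : ∃ C : ℝ, 0 ≤ C ∧ ∀ (R t : ℝ) (h : E3 → ℂ) (P : ℝ),
    0 < R → 1 ≤ t → ContDiff ℝ (⊤ : ℕ∞) h → HasCompactSupport h → (∀ y, R < ‖y‖ → h y = 0) →
    0 ≤ P → (∫ y, ‖h y‖ ^ 2) + (∫ y, ‖fderiv ℝ h y‖ ^ 2) ≤ P ^ 2 →
    ∀ x, ‖waveSin t h x‖ ≤ C * min 1 (R / t) * P := by
  obtain ⟨Q₀, hQ₀, hcut⟩ := exists_cutoff_sphere_bound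
  set v := volume.real (ball (0 : E3) 1)
  have hv : 0 ≤ v := measureReal_nonneg
  refine ⟨Q₀ + √(3 * v + 1), by positivity, fun R t h P hR ht hsm hc hsupp hP0 hP x => ?_⟩
  have ht0 : 0 < t := by linarith
  have hsm1 : ContDiff ℝ 1 h := hsm.of_le (by exact_mod_cast le_top)
  have hdiff : Differentiable ℝ h := hsm1.differentiable (by norm_num)
  have hi0 := integrable_norm_sq_of_hasCompactSupport hsm.continuous hc
  have hi1 := integrable_norm_sq_of_hasCompactSupport (hsm1.continuous_fderiv (by norm_num))
    (hc.fderiv ℝ)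
  have hsq : ContDiff ℝ 1 fun y => ‖h y‖ ^ 2 := hsm1.norm_sq ℝ
  have hsqc : HasCompactSupport fun y => ‖h y‖ ^ 2 :=
    hc.comp_left (g := fun v => ‖v‖ ^ 2) (by simp)
  obtain ⟨p, hp, hple⟩ := exists_hasDerivAt_setIntegral_ball_le hsq hsqc x ht0
  have ha := hasDerivAt_setIntegral_ball_of_fourier hsm.continuous
    (hsm.continuous.integrable_of_hasCompactSupport hc) (integrable_fourier_of_smooth hsm hc) x ht0
  -- As $t\ge1$, the trace inequality gives at most $3\|h\|_2^2+(\|h\|_2^2+\|\nabla h\|_2^2)\le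
  -- 4P^2$.
  have hp2 : p ≤ (2 * P) ^ 2 := by
    have e0 : ∫ y, |‖h y‖ ^ 2| = ∫ y, ‖h y‖ ^ 2 := by simp
    have e1 : ∫ y, ‖fderiv ℝ (fun y => ‖h y‖ ^ 2) y‖ ≤
        (∫ y, ‖h y‖ ^ 2) + ∫ y, ‖fderiv ℝ h y‖ ^ 2 := by
      rw [← integral_add hi0 hi1]
      exact integral_mono_of_nonneg (.of_forall fun y => norm_nonneg _) (hi0.add hi1)
        (.of_forall fun y => norm_fderiv_norm_sq_le hdiff y)
    have e2 : 0 ≤ ∫ y, ‖h y‖ ^ 2 := integral_nonneg fun y => by positivity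
    have e3 : 0 ≤ ∫ y, ‖fderiv ℝ h y‖ ^ 2 := integral_nonneg fun y => by positivity
    have e4 : 3 / t * ∫ y, ‖h y‖ ^ 2 ≤ 3 * ∫ y, ‖h y‖ ^ 2 := by
      gcongr
      exact div_le_self (by norm_num) ht
    rw [e0] at hple
    nlinarith
  have hfin : ∀ Q, 0 < Q → ‖(4 * π * t * waveSin t h x : ℂ)‖ ≤ 2 * P * Q →
      ‖waveSin t h x‖ ≤ Q / t * P := by
    intro Q hQ hle
    have e : ‖(4 * π * t * waveSin t h x : ℂ)‖ = 4 * π * t * ‖waveSin t h x‖ := by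
      simp [abs_of_pos ht0, abs_of_pos pi_pos]
    rw [e] at hle
    have e1 : 0 ≤ t * ‖waveSin t h x‖ := by positivity
    rw [div_mul_eq_mul_div, le_div_iff₀ ht0]
    nlinarith [pi_gt_three]
  rcases le_total R t with hRt | hRt
  · obtain ⟨χ, q, hχ, hχ0, hχ1, hq, hqle⟩ := hcut R t hR hRt x
    have := hfin _ (by positivity) (norm_le_of_hasDerivAt_setIntegral_ball hsm.continuous hχ hχ0
      (fun y hy => hχ1 y (not_lt.1 fun hy' => hy (hsupp y hy'))) ha hp hq (by positivity)
      (mul_pos hQ₀ hR) hp2 hqle)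
    rw [min_eq_right ((div_le_one ht0).2 hRt)]
    refine this.trans ?_
    rw [mul_div_assoc]
    gcongr
    have := sqrt_nonneg (3 * v + 1)
    linarith
  -- When $t\le R$ the whole sphere is used, with cutoff $1$; its area is $3vt^2$.
  · have hq := hasDerivAt_setIntegral_ball (F := fun _ => 1) contDiff_const (K := 0) (by simp) x ht0
    have hqle : 3 * t ^ 2 * (∫ z in ball (0 : E3) 1, (1 : ℝ)) +
        t ^ 3 * ∫ z in ball (0 : E3) 1, fderiv ℝ (fun _ : E3 => (1 : ℝ)) (x + t • z) z
          ≤ (√(3 * v + 1) * t) ^ 2 := by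
      rw [mul_pow, sq_sqrt (by positivity)]
      have e1 : ∫ z in ball (0 : E3) 1, (1 : ℝ) = v := by rw [setIntegral_const]; simp [v]
      rw [e1]
      simp only [fderiv_fun_const, Pi.zero_apply, zero_apply, integral_zero]
      nlinarith [sq_nonneg t]
    have := hfin _ (by positivity) (norm_le_of_hasDerivAt_setIntegral_ball hsm.continuous
      continuous_const (fun y => zero_le_one) (fun y _ => le_rfl) ha hp hq (by positivity)
      (by positivity) hp2 hqle)
    rw [min_eq_left ((one_le_div ht0).2 hRt), mul_one]
    refine this.trans ?_
    rw [mul_div_assoc, div_self ht0.ne', mul_one]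
    gcongr
    linarith

/-! ### Iterated partial derivatives -/

theorem contDiff_partialDeriv {f : E3 → ℂ} (hf : ContDiff ℝ (⊤ : ℕ∞) f) (i : Fin 3) :
    ContDiff ℝ (⊤ : ℕ∞) (partialDeriv i f) :=
  (hf.fderiv_right (m := (⊤ : ℕ∞)) (by simp)).clm_apply contDiff_const

theorem hasCompactSupport_partialDeriv {f : E3 → ℂ} (hc : HasCompactSupport f) (i : Fin 3) :
    HasCompactSupport (partialDeriv i f) :=
  hc.fderiv_apply ℝ _

theorem partialDeriv_eq_zero_of_norm_gt {f : E3 → ℂ} {R : ℝ} (hf : ∀ y, R < ‖y‖ → f y = 0)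
    (i : Fin 3) (y : E3) (hy : R < ‖y‖) : partialDeriv i f y = 0 := by
  have h : f =ᶠ[𝓝 y] fun _ => 0 := by
    filter_upwards [(isOpen_lt continuous_const continuous_norm).mem_nhds hy] with z hz
    exact hf z hz
  rw [partialDeriv, h.fderiv_eq]
  simp

theorem contDiff_iterate_partialDeriv {f : E3 → ℂ} (hf : ContDiff ℝ (⊤ : ℕ∞) f) (i : Fin 3)
    (n : ℕ) : ContDiff ℝ (⊤ : ℕ∞) ((partialDeriv i)^[n] f) := by
  induction n with
  | zero => exact hf
  | succ n ih => rw [Function.iterate_succ_apply']; exact contDiff_partialDeriv ih i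

theorem hasCompactSupport_iterate_partialDeriv {f : E3 → ℂ} (hc : HasCompactSupport f)
    (i : Fin 3) (n : ℕ) : HasCompactSupport ((partialDeriv i)^[n] f) := by
  induction n with
  | zero => exact hc
  | succ n ih => rw [Function.iterate_succ_apply']; exact hasCompactSupport_partialDeriv ih i

theorem iterate_partialDeriv_eq_zero_of_norm_gt {f : E3 → ℂ} {R : ℝ}
    (hf : ∀ y, R < ‖y‖ → f y = 0) (i : Fin 3) (n : ℕ) :
    ∀ y : E3, R < ‖y‖ → (partialDeriv i)^[n] f y = 0 := by
  induction n with
  | zero => exact hf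
  | succ n ih => rw [Function.iterate_succ_apply']; exact partialDeriv_eq_zero_of_norm_gt ih i

theorem partialDeriv_comm {f : E3 → ℂ} (hf : ContDiff ℝ (⊤ : ℕ∞) f) (i j : Fin 3) :
    partialDeriv i (partialDeriv j f) = partialDeriv j (partialDeriv i f) := by
  ext x
  have hd : DifferentiableAt ℝ (fderiv ℝ f) x :=
    (hf.fderiv_right (m := (⊤ : ℕ∞)) (by simp)).differentiable (by simp) x
  have e : ∀ k l : Fin 3, partialDeriv k (partialDeriv l f) x =
      fderiv ℝ (fderiv ℝ f) x (EuclideanSpace.single k 1) (EuclideanSpace.single l 1) := by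
    intro k l
    change fderiv ℝ (fun y => fderiv ℝ f y (EuclideanSpace.single l 1)) x _ = _
    rw [fderiv_clm_apply hd (differentiableAt_const _)]
    simp
  rw [e, e]
  exact (hf.contDiffAt.isSymmSndFDerivAt 
    (by simpa using WithTop.coe_le_coe.2 (le_top : (2 : ℕ∞) ≤ ⊤))) _ _

theorem partialDeriv_iterate_comm {f : E3 → ℂ} (hf : ContDiff ℝ (⊤ : ℕ∞) f) (i j : Fin 3) (n : ℕ) :
    partialDeriv i ((partialDeriv j)^[n] f) = (partialDeriv j)^[n] (partialDeriv i f) := by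
  induction n with
  | zero => rfl
  | succ n ih =>
    rw [Function.iterate_succ_apply', Function.iterate_succ_apply',
      partialDeriv_comm (contDiff_iterate_partialDeriv hf j n), ih]

/-- `multiDeriv` differentiates in a fixed order, so a further derivative has to be commuted into
its slot. -/
theorem partialDeriv_multiDeriv {f : E3 → ℂ} (hf : ContDiff ℝ (⊤ : ℕ∞) f) (i : Fin 3)
    (α : Fin 3 → ℕ) :
    partialDeriv i (multiDeriv α f) = multiDeriv (α + Pi.single i 1) f := by
  have h2 := contDiff_iterate_partialDeriv hf 2 (α 2)
  have h1 := contDiff_iterate_partialDeriv h2 1 (α 1)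
  fin_cases i
  · simp [multiDeriv, Function.iterate_succ_apply']
  · simp only [multiDeriv, Fin.mk_one]
    rw [partialDeriv_iterate_comm h1]
    simp [Function.iterate_succ_apply']
  · simp only [multiDeriv, Fin.reduceFinMk]
    rw [partialDeriv_iterate_comm h1, partialDeriv_iterate_comm h2]
    simp [Function.iterate_succ_apply']

theorem multiDeriv_single (i : Fin 3) (n : ℕ) (f : E3 → ℂ) :
    multiDeriv (Pi.single i n) f = (partialDeriv i)^[n] f := by
  fin_cases i <;> simp [multiDeriv]

theorem mem_multiIndices {k : ℕ} {α : Fin 3 → ℕ} : α ∈ multiIndices k ↔ ∑ i, α i ≤ k := by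
  simp only [multiIndices, Finset.mem_filter, Fintype.mem_piFinset, Finset.mem_range,
    and_iff_right_iff_imp]
  intro h i
  have := Finset.single_le_sum (f := α) (fun j _ => Nat.zero_le _) (Finset.mem_univ i)
  omega

/-! ### The Laplacian and time derivatives on the Fourier side -/

theorem fourier_partialDeriv {f : E3 → ℂ} (hf : ContDiff ℝ (⊤ : ℕ∞) f) (hc : HasCompactSupport f)
    (i : Fin 3) (ξ : E3) : 𝓕 (partialDeriv i f) ξ = 2 * π * Complex.I * ξ i * 𝓕 f ξ := by
  have hd : Integrable (fderiv ℝ f) :=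
    (hf.continuous_fderiv (by simp)).integrable_of_hasCompactSupport (hc.fderiv ℝ)
  have h1 := Real.fourier_fderiv (hf.continuous.integrable_of_hasCompactSupport hc)
    (hf.differentiable (by simp)) hd
  have h2 := Real.fourier_continuousLinearMap_apply (a := EuclideanSpace.single i (1 : ℝ)) (v := ξ) hd
  rw [h1] at h2
  change 𝓕 (fun x => fderiv ℝ f x (EuclideanSpace.single i (1 : ℝ))) ξ = _
  rw [← h2]
  have h3 : innerSL ℝ ξ (EuclideanSpace.single i (1 : ℝ)) = ξ i := by
    rw [innerSL_apply_apply, EuclideanSpace.inner_single_right]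
    simp
  simp [VectorFourier.fourierSMulRight_apply, h3]
  ring

theorem fourier_iterate_partialDeriv {f : E3 → ℂ} (hf : ContDiff ℝ (⊤ : ℕ∞) f)
    (hc : HasCompactSupport f) (i : Fin 3) (n : ℕ) (ξ : E3) :
    𝓕 ((partialDeriv i)^[n] f) ξ = (2 * π * Complex.I * ξ i) ^ n * 𝓕 f ξ := by
  induction n with
  | zero => simp
  | succ n ih =>
    rw [Function.iterate_succ_apply', fourier_partialDeriv (contDiff_iterate_partialDeriv hf i n)
      (hasCompactSupport_iterate_partialDeriv hc i n), ih]
    ring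

/-- The Laplacian in coordinates. -/
def coordLaplacian (f : E3 → ℂ) : E3 → ℂ := fun y => ∑ i, (partialDeriv i)^[2] f y

theorem contDiff_coordLaplacian {f : E3 → ℂ} (hf : ContDiff ℝ (⊤ : ℕ∞) f) :
    ContDiff ℝ (⊤ : ℕ∞) (coordLaplacian f) :=
  ContDiff.sum fun i _ => contDiff_iterate_partialDeriv hf i 2

theorem coordLaplacian_eq_zero_of_norm_gt {f : E3 → ℂ} {R : ℝ}
    (hf : ∀ y, R < ‖y‖ → f y = 0) (y : E3) (hy : R < ‖y‖) : coordLaplacian f y = 0 :=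
  Finset.sum_eq_zero fun i _ => iterate_partialDeriv_eq_zero_of_norm_gt hf i 2 y hy

theorem hasCompactSupport_of_norm_gt {f : E3 → ℂ} {R : ℝ} (hf : ∀ y, R < ‖y‖ → f y = 0) :
    HasCompactSupport f :=
  HasCompactSupport.intro (isCompact_closedBall (0 : E3) R) fun y hy => hf y (by simpa using hy)

theorem fourier_coordLaplacian {f : E3 → ℂ} (hf : ContDiff ℝ (⊤ : ℕ∞) f)
    (hc : HasCompactSupport f) (ξ : E3) :
    𝓕 (coordLaplacian f) ξ = -(2 * π * ‖ξ‖ : ℝ) ^ 2 * 𝓕 f ξ := by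
  have hInt : ∀ i ∈ Finset.univ, Integrable fun v : E3 =>
      Complex.exp (↑(-2 * π * inner ℝ v ξ) * Complex.I) • (partialDeriv i)^[2] f v := by
    intro i _
    have h1 := ((contDiff_iterate_partialDeriv hf i 2).continuous.integrable_of_hasCompactSupport
      (μ := volume) (hasCompactSupport_iterate_partialDeriv hc i 2))
    refine h1.mono ?_ (.of_forall fun v => ?_)
    · have : Continuous fun v : E3 => Complex.exp (↑(-2 * π * inner ℝ v ξ) * Complex.I) := by
        fun_prop
      exact this.aestronglyMeasurable.smul h1.aestronglyMeasurable
    · rw [norm_smul, norm_character, one_mul]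
  have h1 : 𝓕 (coordLaplacian f) ξ = ∑ i, 𝓕 ((partialDeriv i)^[2] f) ξ := by
    simp_rw [Real.fourier_eq', coordLaplacian, Finset.smul_sum]
    exact integral_finsetSum _ hInt
  rw [h1]
  simp_rw [fourier_iterate_partialDeriv hf hc]
  rw [← Finset.sum_mul]
  congr 1
  have hn : ((‖ξ‖ : ℝ) : ℂ) ^ 2 = ∑ i, (ξ i : ℂ) ^ 2 := by
    rw [← Complex.ofReal_pow, EuclideanSpace.norm_sq_eq]
    simp
  push_cast
  rw [mul_pow, hn, Finset.mul_sum, ← Finset.sum_neg_distrib]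
  refine Finset.sum_congr rfl fun i _ => ?_
  rw [mul_pow, mul_pow _ Complex.I, Complex.I_sq]
  ring

/-- The symbols multiply: $-r^2\cdot\sin(sr)/r=\partial_s\cos(sr)$. This is the wave equation, read
as a formula for the second time derivative. -/
theorem waveSin_coordLaplacian {f : E3 → ℂ} (hf : ContDiff ℝ (⊤ : ℕ∞) f)
    (hc : HasCompactSupport f) (s : ℝ) :
    waveSin s (coordLaplacian f) = radialMultiplier (fun r => -(r * Real.sin (s * r))) f := by
  ext x
  rw [waveSin, radialMultiplier_apply, radialMultiplier_apply]
  congr 1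
  ext ξ
  rw [fourier_coordLaplacian hf hc]
  congr 1
  rw [← mul_assoc]
  congr 1
  set r := 2 * π * ‖ξ‖
  by_cases hr : r = 0
  · simp [hr]
  · have : (r : ℂ) ≠ 0 := by exact_mod_cast hr
    push_cast
    field_simp

theorem integrable_radialMultiplier_integrand {m : ℝ → ℝ} (hm : Measurable m) {M : ℝ}
    (hM : ∀ r, 0 < r → |m r| ≤ M) {f : E3 → ℂ} (hf : Integrable (𝓕 f)) (x : E3) :
    Integrable fun ξ : E3 => Complex.exp (↑(2 * π * inner ℝ ξ x) * Complex.I) *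
      ((m (2 * π * ‖ξ‖) : ℂ) * 𝓕 f ξ) := by
  refine (hf.norm.const_mul M).mono' ?_ ?_
  · refine (Continuous.aestronglyMeasurable (by fun_prop)).mul
      (AEStronglyMeasurable.mul ?_ hf.aestronglyMeasurable)
    exact Measurable.aestronglyMeasurable (by fun_prop)
  · have hne : ∀ᵐ ξ : E3, ξ ≠ 0 := by simp [ae_iff]
    filter_upwards [hne] with ξ hξ
    rw [norm_mul, norm_character, one_mul, norm_mul, Complex.norm_real]
    gcongr
    exact hM _ (by have := norm_pos_iff.2 hξ; positivity)

theorem norm_radialMultiplier_le {m : ℝ → ℝ} {M : ℝ}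
    (hM : ∀ r, |m r| ≤ M) {f : E3 → ℂ} (hf : Integrable (𝓕 f)) (x : E3) :
    ‖radialMultiplier m f x‖ ≤ M * ∫ ξ, ‖𝓕 f ξ‖ := by
  rw [radialMultiplier_apply, ← integral_const_mul]
  refine norm_integral_le_of_norm_le (hf.norm.const_mul M) (.of_forall fun ξ => ?_)
  rw [norm_mul, norm_character, one_mul, norm_mul, Complex.norm_real]
  gcongr
  exact hM _

/-- Differentiation of a multiplier with respect to a parameter. -/
theorem hasDerivAt_radialMultiplier {m m' : ℝ → ℝ → ℝ} {f : E3 → ℂ} {s : ℝ} {bound : E3 → ℝ}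
    (hm : ∀ u, Measurable (m u)) (hm' : ∀ u, Measurable (m' u)) {M : ℝ}
    (hM : ∀ r, |m s r| ≤ M)
    (hder : ∀ u r, 0 < r → HasDerivAt (fun u => m u r) (m' u r) u)
    (hf : Integrable (𝓕 f)) (hb : Integrable bound)
    (hle : ∀ u ξ, |m' u (2 * π * ‖ξ‖)| * ‖𝓕 f ξ‖ ≤ bound ξ) (x : E3) :
    HasDerivAt (fun u => radialMultiplier (m u) f x) (radialMultiplier (m' s) f x) s := by
  simp_rw [radialMultiplier_apply]
  have hmeas : ∀ n : ℝ → ℝ, Measurable n → AEStronglyMeasurable (fun ξ : E3 =>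
      Complex.exp (↑(2 * π * inner ℝ ξ x) * Complex.I) * ((n (2 * π * ‖ξ‖) : ℂ) * 𝓕 f ξ)) volume := by
    intro n hn
    refine (Continuous.aestronglyMeasurable (by fun_prop)).mul
      (AEStronglyMeasurable.mul ?_ hf.aestronglyMeasurable)
    exact Measurable.aestronglyMeasurable (by fun_prop)
  refine (hasDerivAt_integral_of_dominated_loc_of_deriv_le (s := Set.univ)
    (F' := fun u ξ => Complex.exp (↑(2 * π * inner ℝ ξ x) * Complex.I) *
      ((m' u (2 * π * ‖ξ‖) : ℂ) * 𝓕 f ξ)) univ_mem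
    (.of_forall fun u => hmeas _ (hm u)) (integrable_radialMultiplier_integrand (hm s)
      (fun r _ => hM r) hf x) (hmeas _ (hm' s)) (.of_forall fun ξ u _ => ?_) hb ?_).2
  · rw [norm_mul, norm_character, one_mul, norm_mul, Complex.norm_real]
    exact hle u ξ
  · have hne : ∀ᵐ ξ : E3, ξ ≠ 0 := by simp [ae_iff]
    filter_upwards [hne] with ξ hξ u _
    have := hder u (2 * π * ‖ξ‖) (by have := norm_pos_iff.2 hξ; positivity)
    exact (this.ofReal_comp.mul_const _).const_mul _

theorem hasDerivAt_waveSin {f : E3 → ℂ} (hf : Integrable (𝓕 f)) (x : E3) {s : ℝ} (hs : 0 ≤ s) :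
    HasDerivAt (fun u => waveSin u f x) (waveCos s f x) s := by
  refine hasDerivAt_radialMultiplier (m := fun u r => Real.sin (u * r) / r)
    (m' := fun u r => Real.cos (u * r)) (bound := fun ξ => ‖𝓕 f ξ‖) (M := s)
    (fun u => by fun_prop) (fun u => by fun_prop) (fun r => abs_sin_mul_div_le hs r) ?_ hf hf.norm
    (fun u ξ => mul_le_of_le_one_left (norm_nonneg _) (Real.abs_cos_le_one _)) x
  intro u r hr
  refine ((((hasDerivAt_id u).mul_const r).sin).div_const r).congr_deriv ?_
  simp [hr.ne']

theorem hasDerivAt_waveCos {f : E3 → ℂ} (hf : ContDiff ℝ (⊤ : ℕ∞) f)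
    (hc : HasCompactSupport f) {R : ℝ} (hR : ∀ y, R < ‖y‖ → f y = 0) (x : E3) (s : ℝ) :
    HasDerivAt (fun u => waveCos u f x) (waveSin s (coordLaplacian f) x) s := by
  have hi := integrable_fourier_of_smooth hf hc
  have hl := integrable_fourier_of_smooth (contDiff_coordLaplacian hf)
    (hasCompactSupport_of_norm_gt (coordLaplacian_eq_zero_of_norm_gt hR))
  rw [waveSin_coordLaplacian hf hc]
  -- The majorant rests on $|r\sin(ur)|\le|r|\le1+r^2$.
  refine hasDerivAt_radialMultiplier (m := fun u r => Real.cos (u * r))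
    (m' := fun u r => -(r * Real.sin (u * r)))
    (bound := fun ξ => ‖𝓕 f ξ‖ + ‖𝓕 (coordLaplacian f) ξ‖) (M := 1)
    (fun u => by fun_prop) (fun u => by fun_prop) (fun r => Real.abs_cos_le_one _) ?_ hi
    (hi.norm.add hl.norm) ?_ x
  · intro u r _
    refine (((hasDerivAt_id u).mul_const r).cos).congr_deriv ?_
    simp
    ring
  · intro u ξ
    rw [fourier_coordLaplacian hf hc, norm_mul, norm_neg, norm_pow, Complex.norm_real, norm_eq_abs,
      sq_abs, abs_neg, abs_mul, ← one_add_mul]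
    gcongr
    set r := 2 * π * ‖ξ‖
    have h1 := Real.abs_sin_le_one (u * r)
    have h2 : |r| * |Real.sin (u * r)| ≤ |r| := mul_le_of_le_one_right (abs_nonneg _) h1
    nlinarith [sq_nonneg (|r| - 1), sq_abs r]

/-- Interpolation of a first derivative between the function and its second derivative. -/
theorem norm_deriv_le_of_norm_second_deriv_le {V : Type*} [NormedAddCommGroup V]
    [NormedSpace ℝ V] {g g' g'' : ℝ → V} {t A M : ℝ}
    (h1 : ∀ s ∈ Set.Icc t (t + 1), HasDerivAt g (g' s) s)
    (h2 : ∀ s ∈ Set.Icc t (t + 1), HasDerivAt g' (g'' s) s)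
    (hA : ∀ s ∈ Set.Icc t (t + 1), ‖g s‖ ≤ A) (hM : ∀ s ∈ Set.Icc t (t + 1), ‖g'' s‖ ≤ M) :
    ‖g' t‖ ≤ 2 * A + M := by
  have hM0 : 0 ≤ M := (norm_nonneg _).trans (hM t ⟨le_rfl, by linarith⟩)
  have k1 : ∀ s ∈ Set.Icc t (t + 1), ‖g' s - g' t‖ ≤ M := by
    intro s hs
    have := norm_image_sub_le_of_norm_deriv_le_segment'
      (fun s hs => (h2 s hs).hasDerivWithinAt) (fun s hs => hM s ⟨hs.1, hs.2.le⟩) s hs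
    nlinarith [hs.1, hs.2]
  -- The mean value inequality for the first-order Taylor remainder at $t$, over a step of length
  -- one.
  have k2 := norm_image_sub_le_of_norm_deriv_le_segment' (f := fun s => g s - (s - t) • g' t)
    (f' := fun s => g' s - g' t) (a := t) (b := t + 1) (C := M)
    (fun s hs => by
      have := ((h1 s hs).sub (((hasDerivAt_id s).sub_const t).smul_const (g' t)))
      exact (this.congr_deriv (by simp)).hasDerivWithinAt) (fun s hs => k1 s ⟨hs.1, hs.2.le⟩) (t + 1)
    ⟨by linarith, le_rfl⟩
  have e : g' t = (g (t + 1) - g t) - (g (t + 1) - ((t + 1) - t) • g' t - (g t - (t - t) • g' t)) := by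
    simp
  have a1 := hA t ⟨le_rfl, by linarith⟩
  have a2 := hA (t + 1) ⟨by linarith, le_rfl⟩
  rw [e]
  refine (norm_sub_le _ _).trans ?_
  have := norm_sub_le (g (t + 1)) (g t)
  have k3 : M * (t + 1 - t) = M := by ring
  linarith

/-! ### Sobolev and Fourier bounds for smooth data -/

theorem sq_sum_three_le (a : Fin 3 → ℝ) : (∑ i, a i) ^ 2 ≤ 3 * ∑ i, a i ^ 2 := by
  simpa using sq_sum_le_card_mul_sum_sq (s := Finset.univ) (f := a)

theorem norm_fderiv_sq_le (h : E3 → ℂ) (y : E3) :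
    ‖fderiv ℝ h y‖ ^ 2 ≤ 3 * ∑ i, ‖partialDeriv i h y‖ ^ 2 := by
  refine le_trans ?_ (sq_sum_three_le fun i => ‖partialDeriv i h y‖)
  gcongr
  refine ContinuousLinearMap.opNorm_le_bound _ (by positivity) fun v => ?_
  have hv : v = ∑ i, v i • EuclideanSpace.single i (1 : ℝ) := by
    ext j
    simp [Finset.sum_apply, Pi.single_apply]
  conv_lhs => rw [hv, map_sum]
  rw [Finset.sum_mul]
  refine norm_sum_le_of_le _ fun i _ => ?_
  rw [map_smul, norm_smul, mul_comm]
  exact mul_le_mul_of_nonneg_left (PiLp.norm_apply_le v i) (norm_nonneg _)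

theorem integral_norm_fderiv_sq_le {h : E3 → ℂ} (hh : ContDiff ℝ (⊤ : ℕ∞) h)
    (hc : HasCompactSupport h) {B : ℝ} (hB : ∀ i, ∫ y, ‖partialDeriv i h y‖ ^ 2 ≤ B) :
    ∫ y, ‖fderiv ℝ h y‖ ^ 2 ≤ 9 * B := by
  have hi : ∀ i, Integrable fun y => ‖partialDeriv i h y‖ ^ 2 := fun i =>
    integrable_norm_sq_of_hasCompactSupport (contDiff_partialDeriv hh i).continuous
      (hasCompactSupport_partialDeriv hc i)
  calc ∫ y, ‖fderiv ℝ h y‖ ^ 2 ≤ ∫ y, 3 * ∑ i, ‖partialDeriv i h y‖ ^ 2 :=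
        integral_mono_of_nonneg (.of_forall fun y => by positivity)
          ((integrable_finsetSum _ fun i _ => hi i).const_mul 3)
          (.of_forall fun y => norm_fderiv_sq_le h y)
    _ = 3 * ∑ i, ∫ y, ‖partialDeriv i h y‖ ^ 2 := by
        rw [integral_const_mul, integral_finsetSum _ fun i _ => hi i]
    _ ≤ 3 * ∑ i : Fin 3, B := by gcongr with i; exact hB i
    _ = 9 * B := by simp; ring

theorem integral_norm_sum_sq_le {g : Fin 3 → E3 → ℂ} (hg : ∀ i, Continuous (g i))
    (hc : ∀ i, HasCompactSupport (g i)) {B : ℝ} (hB : ∀ i, ∫ y, ‖g i y‖ ^ 2 ≤ B) :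
    ∫ y, ‖∑ i, g i y‖ ^ 2 ≤ 9 * B := by
  have hi : ∀ i, Integrable fun y => ‖g i y‖ ^ 2 := fun i =>
    integrable_norm_sq_of_hasCompactSupport (hg i) (hc i)
  calc ∫ y, ‖∑ i, g i y‖ ^ 2 ≤ ∫ y, 3 * ∑ i, ‖g i y‖ ^ 2 := by
        refine integral_mono_of_nonneg (.of_forall fun y => by positivity)
          ((integrable_finsetSum _ fun i _ => hi i).const_mul 3) (.of_forall fun y => ?_)
        refine le_trans ?_ (sq_sum_three_le fun i => ‖g i y‖)
        have := norm_sum_le Finset.univ fun i => g i y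
        change ‖_‖ ^ 2 ≤ _
        gcongr
    _ = 3 * ∑ i, ∫ y, ‖g i y‖ ^ 2 := by
        rw [integral_const_mul, integral_finsetSum _ fun i _ => hi i]
    _ ≤ 3 * ∑ i : Fin 3, B := by gcongr with i; exact hB i
    _ = 9 * B := by simp; ring

theorem partialDeriv_coordLaplacian {f : E3 → ℂ} (hf : ContDiff ℝ (⊤ : ℕ∞) f) (j : Fin 3) (y : E3) :
    partialDeriv j (coordLaplacian f) y =
      ∑ i, multiDeriv (Pi.single i 2 + Pi.single j 1) f y := by
  simp_rw [← partialDeriv_multiDeriv hf, multiDeriv_single]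
  change fderiv ℝ (fun y => ∑ i, (partialDeriv i)^[2] f y) y _ = _
  rw [fderiv_fun_sum fun i _ => (contDiff_iterate_partialDeriv hf i 2).differentiable (by simp) y]
  simp [partialDeriv]

section SmoothBounds

variable {f : E3 → ℂ} {N : ℝ}

theorem contDiff_multiDeriv (hf : ContDiff ℝ (⊤ : ℕ∞) f) (α : Fin 3 → ℕ) :
    ContDiff ℝ (⊤ : ℕ∞) (multiDeriv α f) :=
  contDiff_iterate_partialDeriv (contDiff_iterate_partialDeriv
    (contDiff_iterate_partialDeriv hf _ _) _ _) _ _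

theorem hasCompactSupport_multiDeriv (hc : HasCompactSupport f) (α : Fin 3 → ℕ) :
    HasCompactSupport (multiDeriv α f) :=
  hasCompactSupport_iterate_partialDeriv (hasCompactSupport_iterate_partialDeriv
    (hasCompactSupport_iterate_partialDeriv hc _ _) _ _) _ _

theorem integral_iterate_partialDeriv_sq_le
    (hN : ∀ α ∈ multiIndices 4, ∫ y, ‖multiDeriv α f y‖ ^ 2 ≤ N ^ 2) (i : Fin 3) {n : ℕ}
    (hn : n ≤ 4) : ∫ y, ‖(partialDeriv i)^[n] f y‖ ^ 2 ≤ N ^ 2 := by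
  rw [← multiDeriv_single]
  exact hN _ (mem_multiIndices.2 (by simpa using hn))

theorem h1_bound (hf : ContDiff ℝ (⊤ : ℕ∞) f) (hc : HasCompactSupport f)
    (hN : ∀ α ∈ multiIndices 4, ∫ y, ‖multiDeriv α f y‖ ^ 2 ≤ N ^ 2) :
    (∫ y, ‖f y‖ ^ 2) + (∫ y, ‖fderiv ℝ f y‖ ^ 2) ≤ (10 * N) ^ 2 := by
  have h0 := integral_iterate_partialDeriv_sq_le hN 0 (n := 0) (by norm_num)
  have h1 := integral_norm_fderiv_sq_le hf hc fun i =>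
    integral_iterate_partialDeriv_sq_le hN i (n := 1) (by norm_num)
  simp only [Function.iterate_zero, id] at h0
  nlinarith [sq_nonneg N]

/-- Only derivatives of order two and three enter. The terms contribute $9N^2$ and $81N^2$, which
fit below $(10N)^2$. -/
theorem h1_bound_coordLaplacian (hf : ContDiff ℝ (⊤ : ℕ∞) f) (hc : HasCompactSupport f)
    (hN : ∀ α ∈ multiIndices 4, ∫ y, ‖multiDeriv α f y‖ ^ 2 ≤ N ^ 2)
    (hcl : HasCompactSupport (coordLaplacian f)) :
    (∫ y, ‖coordLaplacian f y‖ ^ 2) + (∫ y, ‖fderiv ℝ (coordLaplacian f) y‖ ^ 2) ≤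
      (10 * N) ^ 2 := by
  have h0 : ∫ y, ‖coordLaplacian f y‖ ^ 2 ≤ 9 * N ^ 2 := integral_norm_sum_sq_le
    (fun i => (contDiff_iterate_partialDeriv hf i 2).continuous)
    (fun i => hasCompactSupport_iterate_partialDeriv hc i 2) fun i =>
    integral_iterate_partialDeriv_sq_le hN i (n := 2) (by norm_num)
  have h1 := integral_norm_fderiv_sq_le (contDiff_coordLaplacian hf) hcl (B := 9 * N ^ 2)
    fun j => by
      simp_rw [partialDeriv_coordLaplacian hf]
      refine integral_norm_sum_sq_le (fun i => (contDiff_multiDeriv hf _).continuous)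
        (fun i => hasCompactSupport_multiDeriv hc _) fun i => hN _ (mem_multiIndices.2 ?_)
      simp [Finset.sum_add_distrib]
  nlinarith [sq_nonneg N]

/-- Reduces the weight to pure powers of single coordinates, so that only iterated derivatives in
one direction are needed. -/
theorem one_add_norm_sq_sq_le (ξ : E3) : (1 + ‖ξ‖ ^ 2) ^ 2 ≤ 2 + 6 * ∑ i, |ξ i| ^ 4 := by
  have h1 : (‖ξ‖ ^ 2) ^ 2 ≤ 3 * ∑ i, |ξ i| ^ 4 := by
    rw [EuclideanSpace.norm_sq_eq]
    refine (sq_sum_three_le _).trans_eq ?_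
    congr 2
    ext i
    rw [norm_eq_abs]
    ring
  nlinarith [sq_nonneg (‖ξ‖ ^ 2 - 1)]

theorem pow_mul_norm_fourier_le (hf : ContDiff ℝ (⊤ : ℕ∞) f) (hc : HasCompactSupport f)
    (i : Fin 3) (n : ℕ) (ξ : E3) :
    |ξ i| ^ n * ‖𝓕 f ξ‖ ≤ ‖𝓕 ((partialDeriv i)^[n] f) ξ‖ := by
  rw [fourier_iterate_partialDeriv hf hc, norm_mul, norm_pow]
  gcongr
  simp only [norm_mul, Complex.norm_I, Complex.norm_real, norm_eq_abs, abs_of_pos pi_pos, mul_one,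
    Complex.norm_ofNat]
  nlinarith [pi_gt_three, abs_nonneg (ξ i)]

theorem integrable_inv_japanese : Integrable fun ξ : E3 => ((1 + ‖ξ‖ ^ 2) ^ 2)⁻¹ := by
  have := integrable_rpow_neg_one_add_norm_sq (E := E3) (μ := volume) (r := 4)
    (by simp; norm_num)
  refine this.congr (.of_forall fun ξ => ?_)
  have e : (-4 / 2 : ℝ) = -(2 : ℕ) := by norm_num
  simp only [e]
  rw [rpow_neg (by positivity), rpow_natCast]

/-- Additive Cauchy–Schwarz against the indicator of the ball with weight $R/N$. The sharp power
would be $R^{3/2}$; $R+R^2$ suffices because only a factor $R$ is needed for small $R$. -/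
theorem integral_norm_le_of_support {R : ℝ} (hR : 0 < R) {g : E3 → ℂ} (hg : Continuous g)
    (hs : ∀ y, R < ‖y‖ → g y = 0) (hN0 : 0 < N) (hN : ∫ y, ‖g y‖ ^ 2 ≤ N ^ 2) :
    ∫ y, ‖g y‖ ≤ (1 + volume.real (ball (0 : E3) 1)) * (R + R ^ 2) * N := by
  have hc := hasCompactSupport_of_norm_gt hs
  have hi := integrable_norm_sq_of_hasCompactSupport hg hc
  have hind : Integrable ((closedBall (0 : E3) R).indicator fun _ => (1 : ℝ)) :=
    (integrable_indicator_iff measurableSet_closedBall).2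
      (integrableOn_const measure_closedBall_lt_top.ne)
  have hv : ∫ y, (closedBall (0 : E3) R).indicator (fun _ => (1 : ℝ)) y =
      R ^ 3 * volume.real (ball (0 : E3) 1) := by
    rw [integral_indicator_const _ measurableSet_closedBall, measureReal_def,
      Measure.addHaar_closedBall _ _ hR.le]
    simp [hR.le, measureReal_def]
  set v := volume.real (ball (0 : E3) 1)
  have hv0 : 0 ≤ v := measureReal_nonneg
  have hpt : ∀ y, ‖g y‖ ≤ R / N * ‖g y‖ ^ 2 +
      N / R * (closedBall (0 : E3) R).indicator (fun _ => (1 : ℝ)) y := by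
    intro y
    by_cases hy : R < ‖y‖
    · have : 0 ≤ (closedBall (0 : E3) R).indicator (fun _ => (1 : ℝ)) y :=
        Set.indicator_nonneg (fun _ _ => zero_le_one) _
      rw [hs y hy]
      simp only [norm_zero]
      positivity
    · rw [Set.indicator_of_mem (by simpa using hy)]
      have : 0 ≤ N / R * (R / N * ‖g y‖ - 1) ^ 2 := by positivity
      have e : N / R * (R / N * ‖g y‖ - 1) ^ 2 = R / N * ‖g y‖ ^ 2 - 2 * ‖g y‖ + N / R := by
        field_simp
        ring
      have := norm_nonneg (g y)
      linarith
  calc ∫ y, ‖g y‖ ≤ ∫ y, (R / N * ‖g y‖ ^ 2 +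
        N / R * (closedBall (0 : E3) R).indicator (fun _ => (1 : ℝ)) y) :=
        integral_mono_of_nonneg (.of_forall fun y => norm_nonneg _)
          ((hi.const_mul _).add (hind.const_mul _)) (.of_forall hpt)
    _ = R / N * (∫ y, ‖g y‖ ^ 2) + N / R * (R ^ 3 * v) := by
        rw [integral_add (hi.const_mul _) (hind.const_mul _), integral_const_mul,
          integral_const_mul, hv]
    _ ≤ R / N * N ^ 2 + N / R * (R ^ 3 * v) := by gcongr
    _ = R * N + v * R ^ 2 * N := by field_simp
    _ ≤ _ := by
        have : 0 ≤ R ^ 2 * N + v * R * N := by positivity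
        linarith

/-- Pointwise decay of the Fourier transform. -/
theorem norm_fourier_le_of_support {R : ℝ} (hR : 0 < R) (hf : ContDiff ℝ (⊤ : ℕ∞) f)
    (hs : ∀ y, R < ‖y‖ → f y = 0) (hN0 : 0 < N)
    (hN : ∀ α ∈ multiIndices 4, ∫ y, ‖multiDeriv α f y‖ ^ 2 ≤ N ^ 2) (ξ : E3) :
    ‖𝓕 f ξ‖ ≤ 20 * (1 + volume.real (ball (0 : E3) 1)) * (R + R ^ 2) * N *
      ((1 + ‖ξ‖ ^ 2) ^ 2)⁻¹ := by
  have hc := hasCompactSupport_of_norm_gt hs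
  have hbd : ∀ i : Fin 3, ∀ n ≤ 4, |ξ i| ^ n * ‖𝓕 f ξ‖ ≤
      (1 + volume.real (ball (0 : E3) 1)) * (R + R ^ 2) * N := by
    intro i n hn
    refine (pow_mul_norm_fourier_le hf hc i n ξ).trans ?_
    refine le_trans ?_ (integral_norm_le_of_support hR
      (contDiff_iterate_partialDeriv hf i n).continuous
      (iterate_partialDeriv_eq_zero_of_norm_gt hs i n) hN0
      (integral_iterate_partialDeriv_sq_le hN i hn))
    exact VectorFourier.norm_fourierIntegral_le_integral_norm _ _ _ _ _
  rw [← div_eq_mul_inv, le_div_iff₀ (by positivity), mul_comm]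
  have h0 := hbd 0 0 (by norm_num)
  rw [pow_zero, one_mul] at h0
  -- The factor $20$ is $2+6\cdot3$, from orders zero and four.
  calc (1 + ‖ξ‖ ^ 2) ^ 2 * ‖𝓕 f ξ‖ ≤ (2 + 6 * ∑ i, |ξ i| ^ 4) * ‖𝓕 f ξ‖ := by
        gcongr
        exact one_add_norm_sq_sq_le ξ
    _ = 2 * ‖𝓕 f ξ‖ + 6 * ∑ i, |ξ i| ^ 4 * ‖𝓕 f ξ‖ := by
        rw [add_mul, mul_assoc 6, Finset.sum_mul]
    _ ≤ 2 * ((1 + volume.real (ball (0 : E3) 1)) * (R + R ^ 2) * N) +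
        6 * ∑ i : Fin 3, (1 + volume.real (ball (0 : E3) 1)) * (R + R ^ 2) * N := by
        refine add_le_add (by gcongr) (mul_le_mul_of_nonneg_left ?_ (by norm_num))
        exact Finset.sum_le_sum fun i _ => hbd i 4 le_rfl
    _ = _ := by
        rw [Finset.sum_const, Finset.card_univ, Fintype.card_fin, nsmul_eq_mul]
        push_cast
        ring

theorem plancherel_of_smooth {g : E3 → ℂ} (hg : ContDiff ℝ (⊤ : ℕ∞) g) (hc : HasCompactSupport g) :
    Integrable (fun ξ => ‖𝓕 g ξ‖ ^ 2) ∧ ∫ ξ, ‖𝓕 g ξ‖ ^ 2 = ∫ y, ‖g y‖ ^ 2 := by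
  constructor
  · exact ((𝓕 (hc.toSchwartzMap hg)).memLp 2 volume).integrable_norm_pow (by norm_num)
  · exact SchwartzMap.integral_norm_sq_fourier (hc.toSchwartzMap hg)

/-- The Fourier transform of a function in `H⁴` is integrable. -/
theorem integral_norm_fourier_le (hf : ContDiff ℝ (⊤ : ℕ∞) f) (hc : HasCompactSupport f)
    (hN0 : 0 < N) (hN : ∀ α ∈ multiIndices 4, ∫ y, ‖multiDeriv α f y‖ ^ 2 ≤ N ^ 2) :
    ∫ ξ, ‖𝓕 f ξ‖ ≤ (20 + ∫ ξ : E3, ((1 + ‖ξ‖ ^ 2) ^ 2)⁻¹) * N := by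
  have hP0 := plancherel_of_smooth hf hc
  have hP := fun i => plancherel_of_smooth (contDiff_iterate_partialDeriv hf i 2)
    (hasCompactSupport_iterate_partialDeriv hc i 2)
  -- Additive Cauchy–Schwarz with weight $J=(1+|\xi|^2)^2$: the part with $J|\hat f|^2$ goes to
  -- Plancherel, and $J^{-1}$ is integrable in dimension three.
  have hpt : ∀ ξ, ‖𝓕 f ξ‖ ≤ N⁻¹ * (2 * ‖𝓕 f ξ‖ ^ 2 +
      6 * ∑ i, ‖𝓕 ((partialDeriv i)^[2] f) ξ‖ ^ 2) + N * ((1 + ‖ξ‖ ^ 2) ^ 2)⁻¹ := by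
    intro ξ
    set J := (1 + ‖ξ‖ ^ 2) ^ 2 with hJ
    have hJ0 : 0 < J := by positivity
    have h1 : J * ‖𝓕 f ξ‖ ^ 2 ≤ 2 * ‖𝓕 f ξ‖ ^ 2 +
        6 * ∑ i, ‖𝓕 ((partialDeriv i)^[2] f) ξ‖ ^ 2 := by
      calc J * ‖𝓕 f ξ‖ ^ 2 ≤ (2 + 6 * ∑ i, |ξ i| ^ 4) * ‖𝓕 f ξ‖ ^ 2 := by
            gcongr
            exact one_add_norm_sq_sq_le ξ
        _ = 2 * ‖𝓕 f ξ‖ ^ 2 + 6 * ∑ i, (|ξ i| ^ 2 * ‖𝓕 f ξ‖) ^ 2 := by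
            rw [add_mul, mul_assoc 6, Finset.sum_mul]
            congr 3
            ext i
            ring
        _ ≤ _ := by
            gcongr with i
            exact pow_mul_norm_fourier_le hf hc i 2 ξ
    have h2 : ‖𝓕 f ξ‖ ≤ N⁻¹ * (J * ‖𝓕 f ξ‖ ^ 2) + N * J⁻¹ := by
      have e1 : 0 ≤ N * J⁻¹ * (N⁻¹ * J * ‖𝓕 f ξ‖ - 1) ^ 2 := by positivity
      have e2 : N * J⁻¹ * (N⁻¹ * J * ‖𝓕 f ξ‖ - 1) ^ 2 =
          N⁻¹ * (J * ‖𝓕 f ξ‖ ^ 2) - 2 * ‖𝓕 f ξ‖ + N * J⁻¹ := by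
        field_simp
        ring
      have := norm_nonneg (𝓕 f ξ)
      linarith
    refine h2.trans ?_
    gcongr
  have hi1 : Integrable fun ξ => N⁻¹ * (2 * ‖𝓕 f ξ‖ ^ 2 +
      6 * ∑ i, ‖𝓕 ((partialDeriv i)^[2] f) ξ‖ ^ 2) :=
    ((hP0.1.const_mul 2).add
      ((integrable_finsetSum _ fun i _ => (hP i).1).const_mul 6)).const_mul _
  refine (integral_mono_of_nonneg (.of_forall fun ξ => norm_nonneg _)
    (hi1.add (integrable_inv_japanese.const_mul N)) (.of_forall hpt)).trans ?_
  have h0 := integral_iterate_partialDeriv_sq_le hN 0 (n := 0) (by norm_num)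
  simp only [Function.iterate_zero, id] at h0
  simp only [Pi.add_apply]
  rw [integral_add hi1 (integrable_inv_japanese.const_mul N), integral_const_mul,
    integral_const_mul, integral_add (hP0.1.const_mul 2)
      ((integrable_finsetSum _ fun i _ => (hP i).1).const_mul 6), integral_const_mul,
    integral_const_mul, integral_finsetSum _ fun i _ => (hP i).1, hP0.2]
  simp_rw [fun i => (hP i).2]
  have h2 : ∑ i, ∫ y, ‖(partialDeriv i)^[2] f y‖ ^ 2 ≤ ∑ i : Fin 3, N ^ 2 :=
    Finset.sum_le_sum fun i _ => integral_iterate_partialDeriv_sq_le hN i (n := 2) (by norm_num)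
  rw [Finset.sum_const, Finset.card_univ, Fintype.card_fin, nsmul_eq_mul] at h2
  push_cast at h2
  calc _ ≤ N⁻¹ * (2 * N ^ 2 + 6 * (3 * N ^ 2)) + N * ∫ ξ : E3, ((1 + ‖ξ‖ ^ 2) ^ 2)⁻¹ := by
        gcongr
    _ = _ := by
        field_simp
        ring

end SmoothBounds

/-! ### The estimate for smooth data -/

/-- The main estimates for smooth data. -/
theorem exists_smooth_bound : ∃ C : ℝ, 0 ≤ C ∧ ∀ (R t : ℝ) (f : E3 → ℂ) (N : ℝ), 0 < R → 0 < t →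
    ContDiff ℝ (⊤ : ℕ∞) f → (∀ y, R < ‖y‖ → f y = 0) → 0 < N →
    (∀ α ∈ multiIndices 4, ∫ y, ‖multiDeriv α f y‖ ^ 2 ≤ N ^ 2) → ∀ x,
      ‖waveSin t f x‖ ≤ C * min 1 ((1 + t)⁻¹ * R) * N ∧
      ‖waveCos t f x‖ ≤ C * min 1 ((1 + t)⁻¹ * R) * N := by
  obtain ⟨C₁, hC₁, hsin⟩ := exists_norm_waveSin_le_of_one_le
  set J := ∫ ξ : E3, ((1 + ‖ξ‖ ^ 2) ^ 2)⁻¹ with hJ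
  have hJ0 : 0 ≤ J := integral_nonneg fun ξ => by positivity
  set v := volume.real (ball (0 : E3) 1)
  have hv0 : 0 ≤ v := measureReal_nonneg
  set C₂ := (20 + J) + 40 * (1 + v) * J with hC₂
  -- For $t\ge1$ the sine bounds are $20C_1\mu N$, and interpolation triples them. For $t\le1$ the
  -- $2$ comes from $\min(1,R)\le2\mu$.
  refine ⟨60 * C₁ + 2 * C₂, by positivity, fun R t f N hR ht hf hs hN0 hN x => ?_⟩
  have hc := hasCompactSupport_of_norm_gt hs
  set μ := min 1 ((1 + t)⁻¹ * R) with hμ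
  have hμ0 : 0 ≤ μ := le_min zero_le_one (by positivity)
  rcases le_total 1 t with h1t | ht1
  · have hmin : min 1 (R / t) ≤ 2 * μ := by
      rw [hμ, mul_min_of_nonneg _ _ (by norm_num : (0 : ℝ) ≤ 2)]
      refine min_le_min (by norm_num) ?_
      rw [div_le_iff₀ ht, inv_mul_eq_div, mul_div_assoc', div_mul_eq_mul_div,
        le_div_iff₀ (by positivity)]
      nlinarith
    have hcl := hasCompactSupport_of_norm_gt (coordLaplacian_eq_zero_of_norm_gt hs)
    have hgen : ∀ s ∈ Set.Icc t (t + 1), ‖waveSin s f x‖ ≤ C₁ * (2 * μ) * (10 * N) ∧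
        ‖waveSin s (coordLaplacian f) x‖ ≤ C₁ * (2 * μ) * (10 * N) := by
      intro s hst
      have hle : min 1 (R / s) ≤ 2 * μ := by
        refine le_trans (min_le_min le_rfl ?_) hmin
        gcongr
        exact hst.1
      constructor
      · refine (hsin R s f (10 * N) hR (h1t.trans hst.1) hf hc hs (by positivity)
          (h1_bound hf hc hN) x).trans ?_
        gcongr
      · refine (hsin R s _ (10 * N) hR (h1t.trans hst.1) (contDiff_coordLaplacian hf) hcl
          (coordLaplacian_eq_zero_of_norm_gt hs) (by positivity)
          (h1_bound_coordLaplacian hf hc hN hcl) x).trans ?_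
        gcongr
    have hi := integrable_fourier_of_smooth hf hc
    have hcos := norm_deriv_le_of_norm_second_deriv_le (t := t)
      (fun s hst => hasDerivAt_waveSin hi x (ht.le.trans hst.1))
      (fun s _ => hasDerivAt_waveCos hf hc hs x s) (fun s hst => (hgen s hst).1)
      (fun s hst => (hgen s hst).2)
    have hsin' := (hgen t ⟨le_rfl, by linarith⟩).1
    have e1 : 0 ≤ C₁ * μ * N := by positivity
    have e2 : 0 ≤ C₂ * μ * N := by positivity
    constructor <;> linarith
  · have hmin : min 1 R ≤ 2 * μ := by
      rw [hμ, mul_min_of_nonneg _ _ (by norm_num : (0 : ℝ) ≤ 2)]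
      refine min_le_min (by norm_num) ?_
      rw [inv_mul_eq_div, mul_div_assoc', le_div_iff₀ (by positivity)]
      nlinarith
    have hi := integrable_fourier_of_smooth hf hc
    -- Plancherel handles $R\ge1$. For $R\le1$ the pointwise decay is integrated and $R+R^2\le2R$
    -- supplies the factor $R$.
    have hF : ∫ ξ, ‖𝓕 f ξ‖ ≤ C₂ * min 1 R * N := by
      rcases le_total 1 R with h1R | hR1
      · rw [min_eq_left h1R, mul_one]
        refine (integral_norm_fourier_le hf hc hN0 hN).trans ?_
        gcongr
        have : 0 ≤ 40 * (1 + v) * J := by positivity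
        linarith
      · rw [min_eq_right hR1]
        calc ∫ ξ, ‖𝓕 f ξ‖ ≤ ∫ ξ : E3, 20 * (1 + v) * (R + R ^ 2) * N * ((1 + ‖ξ‖ ^ 2) ^ 2)⁻¹ :=
              integral_mono_of_nonneg (.of_forall fun ξ => norm_nonneg _)
                (integrable_inv_japanese.const_mul _)
                (.of_forall fun ξ => norm_fourier_le_of_support hR hf hs hN0 hN ξ)
          _ = 20 * (1 + v) * (R + R ^ 2) * N * J := by rw [integral_const_mul]
          _ ≤ 20 * (1 + v) * (2 * R) * N * J := by
              gcongr
              nlinarith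
          _ ≤ _ := by
              have : 0 ≤ (20 + J) * R * N := by positivity
              rw [hC₂]
              linarith
    have hfin : ∫ ξ, ‖𝓕 f ξ‖ ≤ (60 * C₁ + 2 * C₂) * μ * N := by
      refine hF.trans ?_
      have e1 : C₂ * min 1 R * N ≤ C₂ * (2 * μ) * N := by gcongr
      have e2 : 0 ≤ C₁ * μ * N := by positivity
      linarith
    constructor
    · refine (norm_radialMultiplier_le (M := 1) (fun r => ?_) hi x).trans (by rwa [one_mul])
      exact (abs_sin_mul_div_le ht.le r).trans ht1
    · exact (norm_radialMultiplier_le (M := 1) (fun r => Real.abs_cos_le_one _) hi x).trans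
        (by rwa [one_mul])

/-! ### Mollification -/

/-- The convolution of two complex-valued functions on `ℝ³`. -/
def conv (f ρ : E3 → ℂ) : E3 → ℂ := fun x => ∫ t, f t * ρ (x - t)

/-- The real-bilinear form serves differentiation, the complex-bilinear one the Fourier transform.
-/
theorem conv_eq_real (f ρ : E3 → ℂ) :
    conv f ρ = convolution f ρ (ContinuousLinearMap.mul ℝ ℂ) volume := rfl

theorem conv_eq_complex (f ρ : E3 → ℂ) :
    conv f ρ = convolution f ρ (ContinuousLinearMap.mul ℂ ℂ) volume := rfl

section Derivatives

variable {f ρ : E3 → ℂ}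

theorem contDiff_conv (hf : LocallyIntegrable f) (hρ : ContDiff ℝ (⊤ : ℕ∞) ρ)
    (hc : HasCompactSupport ρ) : ContDiff ℝ (⊤ : ℕ∞) (conv f ρ) :=
  hc.contDiff_convolution_right (ContinuousLinearMap.mul ℝ ℂ) hf hρ

theorem partialDeriv_conv (hf : LocallyIntegrable f) (hρ : ContDiff ℝ (⊤ : ℕ∞) ρ)
    (hc : HasCompactSupport ρ) (i : Fin 3) :
    partialDeriv i (conv f ρ) = conv f (partialDeriv i ρ) := by
  ext x
  have h1 := hc.hasFDerivAt_convolution_right (ContinuousLinearMap.mul ℝ ℂ) hf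
    (hρ.of_le (by exact_mod_cast le_top)) x
  rw [partialDeriv, conv_eq_real, h1.fderiv,
    convolution_precompR_apply _ hf (hc.fderiv ℝ) (hρ.continuous_fderiv (by simp))]
  rfl

theorem iterate_partialDeriv_conv (hf : LocallyIntegrable f) (hρ : ContDiff ℝ (⊤ : ℕ∞) ρ)
    (hc : HasCompactSupport ρ) (i : Fin 3) (n : ℕ) :
    (partialDeriv i)^[n] (conv f ρ) = conv f ((partialDeriv i)^[n] ρ) := by
  induction n with
  | zero => rfl
  | succ n ih =>
    rw [Function.iterate_succ_apply', Function.iterate_succ_apply', ih,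
      partialDeriv_conv hf (contDiff_iterate_partialDeriv hρ i n)
        (hasCompactSupport_iterate_partialDeriv hc i n)]

theorem multiDeriv_conv (hf : LocallyIntegrable f) (hρ : ContDiff ℝ (⊤ : ℕ∞) ρ)
    (hc : HasCompactSupport ρ) (α : Fin 3 → ℕ) :
    multiDeriv α (conv f ρ) = conv f (multiDeriv α ρ) := by
  have s2 := contDiff_iterate_partialDeriv hρ 2 (α 2)
  have c2 := hasCompactSupport_iterate_partialDeriv hc 2 (α 2)
  simp only [multiDeriv]
  rw [iterate_partialDeriv_conv hf hρ hc, iterate_partialDeriv_conv hf s2 c2,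
    iterate_partialDeriv_conv hf (contDiff_iterate_partialDeriv s2 _ _)
      (hasCompactSupport_iterate_partialDeriv c2 _ _)]

/-- The constant $c$ carries the signs already collected when the three directions are treated in
turn. -/
theorem iterate_partialDeriv_reflect (hρ : ContDiff ℝ (⊤ : ℕ∞) ρ) (i : Fin 3) (n : ℕ) (x : E3)
    (c : ℂ) : (partialDeriv i)^[n] (fun t => c * ρ (x - t)) =
      fun t => c * (-1) ^ n * (partialDeriv i)^[n] ρ (x - t) := by
  induction n with
  | zero => simp
  | succ n ih =>
    rw [Function.iterate_succ_apply', ih]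
    have hs := contDiff_iterate_partialDeriv hρ i n
    ext t
    have h1 : HasFDerivAt (fun t : E3 => (partialDeriv i)^[n] ρ (x - t))
        (-(fderiv ℝ ((partialDeriv i)^[n] ρ) (x - t))) t := by
      have := (hs.differentiable (by simp) (x - t)).hasFDerivAt.comp t
        ((hasFDerivAt_id t).const_sub x)
      refine this.congr_fderiv ?_
      ext v
      simp
    rw [partialDeriv, (h1.const_mul (c * (-1) ^ n)).fderiv, Function.iterate_succ_apply']
    simp [partialDeriv]
    ring

theorem multiDeriv_reflect (hρ : ContDiff ℝ (⊤ : ℕ∞) ρ) (α : Fin 3 → ℕ) (x t : E3) :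
    multiDeriv α (fun t => ρ (x - t)) t = (-1) ^ (∑ i, α i) * multiDeriv α ρ (x - t) := by
  have s2 := contDiff_iterate_partialDeriv hρ 2 (α 2)
  have s1 := contDiff_iterate_partialDeriv s2 1 (α 1)
  have h2 := iterate_partialDeriv_reflect hρ 2 (α 2) x 1
  simp only [one_mul] at h2
  simp only [multiDeriv]
  rw [h2, iterate_partialDeriv_reflect s2, iterate_partialDeriv_reflect s1, Fin.sum_univ_three]
  ring

/-- Mollification turns weak derivatives into classical ones. -/
theorem multiDeriv_conv_of_hasWeakDeriv {g : E3 → ℂ} {α : Fin 3 → ℕ}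
    (h : HasWeakDeriv Set.univ α f g) (hρ : ContDiff ℝ (⊤ : ℕ∞) ρ) (hc : HasCompactSupport ρ) :
    multiDeriv α (conv f ρ) = conv g ρ := by
  obtain ⟨hf, -, hφ⟩ := h
  rw [multiDeriv_conv (locallyIntegrableOn_univ.1 hf) hρ hc]
  ext x
  -- Testing against the reflected kernel: its sign $(-1)^{|\alpha|}$ cancels the sign in the
  -- definition of the weak derivative.
  have h1 := hφ (fun t => ρ (x - t)) (hρ.comp (contDiff_const.sub contDiff_id))
    (hc.comp_homeomorph (Homeomorph.subLeft x)) (Set.subset_univ _)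
  simp_rw [multiDeriv_reflect hρ, Measure.restrict_univ] at h1
  have h2 : ∀ t, f t * ((-1) ^ (∑ i, α i) * multiDeriv α ρ (x - t)) =
      (-1) ^ (∑ i, α i) * (f t * multiDeriv α ρ (x - t)) := fun t => by ring
  simp_rw [h2, integral_const_mul] at h1
  exact mul_left_cancel₀ (pow_ne_zero _ (by norm_num)) h1

end Derivatives

/-- A complex-valued approximate identity. -/
def bump (η : ContDiffBump (0 : E3)) : E3 → ℂ := fun y => (η.normed volume y : ℂ)

variable (η : ContDiffBump (0 : E3))

theorem contDiff_bump : ContDiff ℝ (⊤ : ℕ∞) (bump η) :=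
  Complex.ofRealCLM.contDiff.comp η.contDiff_normed

theorem hasCompactSupport_bump : HasCompactSupport (bump η) :=
  η.hasCompactSupport_normed.comp_left (g := Complex.ofReal) rfl

theorem norm_bump (y : E3) : ‖bump η y‖ = η.normed volume y := by
  rw [bump, Complex.norm_real, norm_eq_abs, abs_of_nonneg (η.nonneg_normed y)]

theorem bump_eq_zero {y : E3} (hy : η.rOut ≤ ‖y‖) : bump η y = 0 := by
  have : y ∉ Function.support (η.normed volume) := by
    rw [η.support_normed_eq]
    simpa using hy
  simp [bump, Function.notMem_support.1 this]

/-- The weight is a probability density and a variance is nonnegative: expand $\int(h-a)^2$ with $a$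
the mean. -/
theorem sq_integral_conv_le {h : E3 → ℝ} (hh : LocallyIntegrable h)
    (hh2 : LocallyIntegrable fun y => h y ^ 2) (x : E3) :
    (∫ t, h t * η.normed volume (x - t)) ^ 2 ≤ ∫ t, h t ^ 2 * η.normed volume (x - t) := by
  have hi : ∀ {k : E3 → ℝ}, LocallyIntegrable k →
      Integrable fun t => k t * η.normed volume (x - t) := fun {k} hk =>
    η.hasCompactSupport_normed.convolutionExists_right (ContinuousLinearMap.mul ℝ ℝ) hk
      η.continuous_normed x
  have hη : Integrable fun t => η.normed volume (x - t) := η.integrable_normed.comp_sub_left x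
  have hη1 : ∫ t, η.normed volume (x - t) = 1 := by
    rw [integral_sub_left_eq_self (fun t => η.normed volume t), η.integral_normed]
  set a := ∫ t, h t * η.normed volume (x - t) with ha
  have h0 : 0 ≤ ∫ t, (h t ^ 2 * η.normed volume (x - t) -
      2 * a * (h t * η.normed volume (x - t)) + a ^ 2 * η.normed volume (x - t)) := by
    refine integral_nonneg fun t => ?_
    have e : h t ^ 2 * η.normed volume (x - t) -
      2 * a * (h t * η.normed volume (x - t)) + a ^ 2 * η.normed volume (x - t) =
      (h t - a) ^ 2 * η.normed volume (x - t) := by ring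
    simp only [e]
    exact mul_nonneg (sq_nonneg _) (η.nonneg_normed _)
  have hsub : Integrable fun t => h t ^ 2 * η.normed volume (x - t) -
      2 * a * (h t * η.normed volume (x - t)) := (hi hh2).sub ((hi hh).const_mul _)
  rw [integral_add hsub (hη.const_mul _),
    integral_sub (hi hh2) ((hi hh).const_mul _), integral_const_mul, integral_const_mul,
    hη1, ← ha] at h0
  nlinarith

/-- Mollification does not increase the `L²` norm. -/
theorem integral_norm_conv_bump_sq_le {g : E3 → ℂ} (hg : LocallyIntegrable g)
    (hg2 : Integrable fun y => ‖g y‖ ^ 2) :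
    ∫ x, ‖conv g (bump η) x‖ ^ 2 ≤ ∫ y, ‖g y‖ ^ 2 := by
  have hInt := hg2.integrable_convolution (ContinuousLinearMap.mul ℝ ℝ)
    (η.integrable_normed (μ := volume))
  have h1 := integral_convolution (ContinuousLinearMap.mul ℝ ℝ) hg2
    (η.integrable_normed (μ := volume))
  rw [η.integral_normed] at h1
  simp only [ContinuousLinearMap.mul_apply', mul_one] at h1
  rw [← h1]
  refine integral_mono_of_nonneg (.of_forall fun x => by positivity) hInt (.of_forall fun x => ?_)
  refine le_trans ?_ (sq_integral_conv_le η (fun y => (hg y).norm) hg2.locallyIntegrable x)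
  have h2 : ‖conv g (bump η) x‖ ≤ ∫ t, ‖g t‖ * η.normed volume (x - t) := by
    refine (norm_integral_le_integral_norm _).trans_eq ?_
    simp_rw [norm_mul, norm_bump]
  change ‖_‖ ^ 2 ≤ _
  gcongr

theorem conv_bump_eq_zero {f : E3 → ℂ} {R : ℝ} (hf : ∀ᵐ y, R < ‖y‖ → f y = 0) (x : E3)
    (hx : R + η.rOut < ‖x‖) : conv f (bump η) x = 0 := by
  refine integral_eq_zero_of_ae ?_
  filter_upwards [hf] with t ht
  by_cases h : R < ‖t‖
  · simp [ht h]
  · rw [bump_eq_zero η, mul_zero, Pi.zero_apply]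
    have := norm_sub_norm_le x t
    linarith

theorem integrable_bump : Integrable (bump η) := η.integrable_normed.ofReal

theorem fourier_conv_bump {f : E3 → ℂ} (hf : Integrable f) (ξ : E3) :
    𝓕 (conv f (bump η)) ξ = 𝓕 f ξ * 𝓕 (bump η) ξ := by
  rw [conv_eq_complex]
  exact Real.fourier_mul_convolution_eq hf (integrable_bump η) ξ

theorem norm_fourier_bump_le (ξ : E3) : ‖𝓕 (bump η) ξ‖ ≤ 1 := by
  refine (VectorFourier.norm_fourierIntegral_le_integral_norm _ _ _ _ _).trans_eq ?_
  simp_rw [norm_bump]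
  exact η.integral_normed

/-- The transform at $\xi$ is the value at $0$ of a character convolved with an approximate
identity. -/
theorem tendsto_fourier_bump {ι : Type*} {l : Filter ι} {η : ι → ContDiffBump (0 : E3)}
    (hη : Tendsto (fun n => (η n).rOut) l (𝓝 0)) (ξ : E3) :
    Tendsto (fun n => 𝓕 (bump (η n)) ξ) l (𝓝 1) := by
  have h := ContDiffBump.convolution_tendsto_right_of_continuous (μ := volume) hη
    (g := fun y : E3 => Complex.exp (↑(2 * π * inner ℝ y ξ) * Complex.I)) (by fun_prop) 0
  simp only [inner_zero_left, mul_zero, Complex.ofReal_zero, zero_mul, Complex.exp_zero] at h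
  refine h.congr fun n => ?_
  rw [Real.fourier_eq', convolution_def]
  congr 1
  ext y
  simp only [ContinuousLinearMap.lsmul_apply, zero_sub, inner_neg_left, bump, Complex.real_smul,
    smul_eq_mul]
  rw [mul_comm]
  congr 3
  push_cast
  ring

/-! ### Uniqueness of weak derivatives and the norm on the ball -/

theorem tsupport_iterate_partialDeriv_subset (φ : E3 → ℂ) (i : Fin 3) (n : ℕ) :
    tsupport ((partialDeriv i)^[n] φ) ⊆ tsupport φ := by
  induction n with
  | zero => exact subset_rfl
  | succ n ih =>
    rw [Function.iterate_succ_apply']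
    exact (tsupport_fderiv_apply_subset ℝ _).trans ih

theorem tsupport_multiDeriv_subset (φ : E3 → ℂ) (α : Fin 3 → ℕ) :
    tsupport (multiDeriv α φ) ⊆ tsupport φ :=
  (tsupport_iterate_partialDeriv_subset _ _ _).trans
    ((tsupport_iterate_partialDeriv_subset _ _ _).trans (tsupport_iterate_partialDeriv_subset _ _ _))

theorem integrable_mul_of_tsupport_subset {U : Set E3} {g φ : E3 → ℂ}
    (hg : LocallyIntegrableOn g U) (hφ : Continuous φ) (hc : HasCompactSupport φ)
    (hU : tsupport φ ⊆ U) : Integrable fun x => g x * φ x := by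
  have h1 : IntegrableOn g (tsupport φ) := hg.integrableOn_compact_subset hU hc
  have h2 : IntegrableOn (fun x => g x * φ x) (tsupport φ) :=
    h1.mul_continuousOn hφ.continuousOn hc
  refine (integrableOn_iff_integrable_of_support_subset fun x hx => ?_).1 h2
  exact subset_tsupport φ (right_ne_zero_of_mul hx)

theorem setIntegral_mul_eq_of_tsupport_subset {U : Set E3} {g φ : E3 → ℂ} (hU : tsupport φ ⊆ U) :
    ∫ x in U, g x * φ x = ∫ x, g x * φ x :=
  setIntegral_eq_integral_of_forall_compl_eq_zero fun x hx => by
    rw [image_eq_zero_of_notMem_tsupport fun h => hx (hU h), mul_zero]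

/-- Weak derivatives are local and unique. -/
theorem ae_eq_of_hasWeakDeriv {U : Set E3} (hU : IsOpen U) {α : Fin 3 → ℕ} {f g g' : E3 → ℂ}
    (hg' : HasWeakDeriv U α f g') (hg : HasWeakDeriv Set.univ α f g) :
    ∀ᵐ x, x ∈ U → g' x = g x := by
  have hgU : LocallyIntegrableOn g U := hg.2.1.mono_set (Set.subset_univ _)
  have key := hU.ae_eq_zero_of_integral_contDiff_smul_eq_zero (hg'.2.1.sub hgU) (μ := volume) ?_
  · filter_upwards [key] with x hx hxU
    exact sub_eq_zero.1 (hx hxU)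
  · intro φ hφ hc hφU
    let ψ : E3 → ℂ := fun x => φ x
    have hψ : ContDiff ℝ (⊤ : ℕ∞) ψ := Complex.ofRealCLM.contDiff.comp hφ
    have hψc : HasCompactSupport ψ := hc.comp_left (g := Complex.ofReal) rfl
    have hψU : tsupport ψ ⊆ U := by
      refine subset_trans (closure_mono fun x hx => ?_) hφU
      intro h0
      exact hx (by simp [ψ, h0])
    have e1 := hg'.2.2 ψ hψ hψc hψU
    have e2 := hg.2.2 ψ hψ hψc (Set.subset_univ _)
    rw [setIntegral_mul_eq_of_tsupport_subset ((tsupport_multiDeriv_subset ψ α).trans hψU),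
      setIntegral_mul_eq_of_tsupport_subset hψU] at e1
    rw [Measure.restrict_univ, e1] at e2
    have e3 := mul_left_cancel₀ (pow_ne_zero _ (by norm_num)) e2
    have e4 : ∀ x, φ x • (g' - g) x = g' x * ψ x - g x * ψ x := by
      intro x
      simp only [Pi.sub_apply, Complex.real_smul, ψ]
      ring
    simp_rw [e4]
    rw [integral_sub (integrable_mul_of_tsupport_subset hg'.2.1 hψ.continuous hψc hψU)
      (integrable_mul_of_tsupport_subset hgU hψ.continuous hψc hψU), e3, sub_self]

theorem hasWeakDeriv_zero_of_ae {U : Set E3} (hU : MeasurableSet U) {f : E3 → ℂ}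
    (hf : LocallyIntegrableOn f U) (h0 : ∀ᵐ x, x ∈ U → f x = 0) (α : Fin 3 → ℕ) :
    HasWeakDeriv U α f 0 := by
  refine ⟨hf, locallyIntegrable_zero.locallyIntegrableOn _, fun φ _ _ _ => ?_⟩
  have : ∫ x in U, f x * multiDeriv α φ x = 0 := by
    refine integral_eq_zero_of_ae ?_
    filter_upwards [(ae_restrict_iff' hU).2 h0] with x hx
    simp [hx]
  simp [this]

/-- For a function supported in a ball, the Sobolev norms on the ball and on `ℝ³` agree. -/
theorem le_sobolevNorm_ball {k : ℕ} {R : ℝ} {f : E3 → ℂ}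
    (hf : ∀ᵐ x, x ∉ closedBall (0 : E3) R → f x = 0) {g : (Fin 3 → ℕ) → E3 → ℂ}
    (hg : ∀ α ∈ multiIndices k, HasWeakDeriv Set.univ α f (g α)) :
    (∑ α ∈ multiIndices k, eLpNorm (g α) 2 volume ^ 2) ^ (1 / 2 : ℝ) ≤
      sobolevNorm k (ball (0 : E3) R) f := by
  refine le_iInf₂ fun g' hg' => ?_
  refine ENNReal.rpow_le_rpow (Finset.sum_le_sum fun α hα => ?_) (by norm_num)
  gcongr 1
  refine le_of_eq ?_
  rw [← eLpNorm_indicator_eq_eLpNorm_restrict measurableSet_ball]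
  refine eLpNorm_congr_ae ?_
  -- The two families agree inside the ball, the global one vanishes off the closed ball, and the
  -- sphere between is null.
  have h1 := ae_eq_of_hasWeakDeriv isOpen_ball (hg' α hα) (hg α hα)
  have h2 := ae_eq_of_hasWeakDeriv (U := (closedBall (0 : E3) R)ᶜ) isClosed_closedBall.isOpen_compl
    (hasWeakDeriv_zero_of_ae isClosed_closedBall.isOpen_compl.measurableSet
      ((hg α hα).1.mono_set (Set.subset_univ _)) hf α) (hg α hα)
  have h3 : ∀ᵐ x : E3, x ∉ sphere (0 : E3) R := by
    refine measure_eq_zero_iff_ae_notMem.1 ?_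
    exact Measure.addHaar_sphere _ _ _
  filter_upwards [h1, h2, h3] with x h1 h2 h3
  by_cases hx : x ∈ ball (0 : E3) R
  · rw [Set.indicator_of_mem hx, h1 hx]
  · rw [Set.indicator_of_notMem hx, ← h2, Pi.zero_apply]
    simp only [mem_ball_zero_iff, mem_sphere_zero_iff_norm, Set.mem_compl_iff,
      mem_closedBall_zero_iff, not_lt, not_le] at *
    exact lt_of_le_of_ne hx (Ne.symm h3)

theorem integrable_of_ae_support {f : E3 → ℂ} {R : ℝ} (hloc : LocallyIntegrable f)
    (hf : ∀ᵐ x, x ∉ closedBall (0 : E3) R → f x = 0) : Integrable f := by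
  have h1 := (integrable_indicator_iff measurableSet_closedBall).2
    (hloc.integrableOn_isCompact (isCompact_closedBall (0 : E3) R))
  refine h1.congr ?_
  filter_upwards [hf] with x hx
  by_cases h : x ∈ closedBall (0 : E3) R
  · rw [Set.indicator_of_mem h]
  · rw [Set.indicator_of_notMem h, hx h]

theorem integrable_norm_sq_and_integral_le {g : E3 → ℂ} (hg : AEStronglyMeasurable g volume)
    {S : ℝ≥0∞} (hS : S ≠ ∞) (h : eLpNorm g 2 volume ^ 2 ≤ S ^ 2) :
    Integrable (fun y => ‖g y‖ ^ 2) ∧ ∫ y, ‖g y‖ ^ 2 ≤ S.toReal ^ 2 := by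
  have h1 : eLpNorm g 2 volume < ∞ := by
    by_contra! h2
    rw [top_le_iff.1 h2] at h
    simp [hS] at h
  have hm : MemLp g 2 volume := ⟨hg, h1⟩
  have hi : Integrable (fun y => ‖g y‖ ^ 2) := hm.integrable_norm_pow (by norm_num)
  refine ⟨hi, ?_⟩
  rw [← ENNReal.toReal_pow, ← ENNReal.ofReal_le_iff_le_toReal (by simp [hS]),
    ofReal_integral_eq_lintegral_ofReal hi (.of_forall fun y => by positivity)]
  refine le_trans (le_of_eq ?_) h
  have h2 := eLpNorm_nnreal_pow_eq_lintegral (μ := volume) (f := g) (p := 2) (by norm_num)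
  norm_num at h2
  rw [h2]
  congr 1
  ext y
  rw [ENNReal.ofReal_pow (norm_nonneg _), ofReal_norm]

/-! ### Removing the mollification -/

section Limit

variable {f : E3 → ℂ} {ι : Type*} {l : Filter ι} {η : ι → ContDiffBump (0 : E3)}

theorem tendsto_fourier_conv_bump (hf : Integrable f)
    (hη : Tendsto (fun n => (η n).rOut) l (𝓝 0)) (ξ : E3) :
    Tendsto (fun n => 𝓕 (conv f (bump (η n))) ξ) l (𝓝 (𝓕 f ξ)) := by
  simp_rw [fourier_conv_bump _ hf]
  simpa using (tendsto_fourier_bump hη ξ).const_mul (𝓕 f ξ)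

/-- Dominated convergence with majorant $M|\hat f|$, since the transform of a bump has modulus at
most one. -/
theorem tendsto_radialMultiplier_conv_bump [l.IsCountablyGenerated] (hf : Integrable f)
    (hf' : Integrable (𝓕 f)) (hη : Tendsto (fun n => (η n).rOut) l (𝓝 0)) {m : ℝ → ℝ}
    (hm : Measurable m) {M : ℝ} (hM : ∀ r, |m r| ≤ M) (x : E3) :
    Tendsto (fun n => radialMultiplier m (conv f (bump (η n))) x) l
      (𝓝 (radialMultiplier m f x)) := by
  simp_rw [radialMultiplier_apply]
  refine tendsto_integral_filter_of_dominated_convergence (fun ξ => M * ‖𝓕 f ξ‖)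
    (.of_forall fun n => ?_) (.of_forall fun n => .of_forall fun ξ => ?_) (hf'.norm.const_mul M)
    (.of_forall fun ξ => ?_)
  · have hF : 𝓕 (conv f (bump (η n))) = fun ξ => 𝓕 f ξ * 𝓕 (bump (η n)) ξ :=
      funext fun ξ => fourier_conv_bump _ hf ξ
    have hb : Integrable (𝓕 (bump (η n))) :=
      integrable_fourier_of_smooth (contDiff_bump _) (hasCompactSupport_bump _)
    refine (Continuous.aestronglyMeasurable (by fun_prop)).mul (AEStronglyMeasurable.mul
      (Measurable.aestronglyMeasurable (by fun_prop)) ?_)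
    rw [hF]
    exact hf'.aestronglyMeasurable.mul hb.aestronglyMeasurable
  · rw [norm_mul, norm_character, one_mul, norm_mul, Complex.norm_real, fourier_conv_bump _ hf,
      norm_mul]
    refine mul_le_mul (hM _) ?_ (by positivity) ((abs_nonneg _).trans (hM 0))
    exact mul_le_of_le_one_right (norm_nonneg _) (norm_fourier_bump_le _ ξ)
  · exact ((tendsto_fourier_conv_bump hf hη ξ).const_mul _).const_mul _

end Limit

/-- Bump functions with supports shrinking to the origin. -/
def shrinkingBump (n : ℕ) : ContDiffBump (0 : E3) where
  rIn := 1 / (n + 1) / 2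
  rOut := 1 / (n + 1)
  rIn_pos := by positivity
  rIn_lt_rOut := half_lt_self (by positivity)

theorem tendsto_rOut_shrinkingBump : Tendsto (fun n => (shrinkingBump n).rOut) atTop (𝓝 0) :=
  tendsto_one_div_add_atTop_nhds_zero_nat

theorem rOut_shrinkingBump_le (n : ℕ) : (shrinkingBump n).rOut ≤ 1 := by
  change 1 / ((n : ℝ) + 1) ≤ 1
  rw [div_le_one (by positivity)]
  have : (0 : ℝ) ≤ n := n.cast_nonneg
  linarith

/-- The estimates for data with weak derivatives in `L²`. -/
theorem exists_weak_bound : ∃ C : ℝ, 0 ≤ C ∧ ∀ (R t : ℝ) (f : E3 → ℂ)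
    (g : (Fin 3 → ℕ) → E3 → ℂ) (N : ℝ), 0 < R → 0 < t → Integrable f →
    (∀ᵐ x, x ∉ closedBall (0 : E3) R → f x = 0) →
    (∀ α ∈ multiIndices 4, HasWeakDeriv Set.univ α f (g α)) → 0 < N →
    (∀ α ∈ multiIndices 4, Integrable (fun y => ‖g α y‖ ^ 2) ∧ ∫ y, ‖g α y‖ ^ 2 ≤ N ^ 2) →
      Integrable (𝓕 f) ∧ ∀ x,
      ‖waveSin t f x‖ ≤ C * min 1 ((1 + t)⁻¹ * R) * N ∧
      ‖waveCos t f x‖ ≤ C * min 1 ((1 + t)⁻¹ * R) * N := by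
  obtain ⟨C, hC, hsmooth⟩ := exists_smooth_bound
  refine ⟨C, hC, fun R t f g N hR ht hf hsupp hg hN0 hN => ?_⟩
  let F : ℕ → E3 → ℂ := fun n => conv f (bump (shrinkingBump n))
  have hη := tendsto_rOut_shrinkingBump
  have hFs : ∀ n, ContDiff ℝ (⊤ : ℕ∞) (F n) := fun n =>
    contDiff_conv hf.locallyIntegrable (contDiff_bump _) (hasCompactSupport_bump _)
  have hF0 : ∀ n y, R + (shrinkingBump n).rOut < ‖y‖ → F n y = 0 := fun n y hy =>
    conv_bump_eq_zero _ (by simpa using hsupp) y hy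
  have hFN : ∀ n, ∀ α ∈ multiIndices 4, ∫ y, ‖multiDeriv α (F n) y‖ ^ 2 ≤ N ^ 2 := by
    intro n α hα
    have e : multiDeriv α (F n) = conv (g α) (bump (shrinkingBump n)) :=
      multiDeriv_conv_of_hasWeakDeriv (hg α hα) (contDiff_bump _) (hasCompactSupport_bump _)
    rw [e]
    exact (integral_norm_conv_bump_sq_le _ (locallyIntegrableOn_univ.1 (hg α hα).2.1)
      (hN α hα).1).trans (hN α hα).2
  have hrpos : ∀ n, 0 < R + (shrinkingBump n).rOut := fun n =>
    add_pos hR (shrinkingBump n).rOut_pos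
  have hInt : Integrable (𝓕 f) := by
    have hcont : Continuous (𝓕 f) := VectorFourier.fourierIntegral_continuous
      Real.continuous_fourierChar (by exact continuous_inner) hf
    -- All mollified functions vanish outside the ball of radius $R+1$, so one decay bound holds for
    -- all of them and survives the limit.
    refine (integrable_inv_japanese.const_mul (20 * (1 + volume.real (ball (0 : E3) 1)) *
      ((R + 1) + (R + 1) ^ 2) * N)).mono' hcont.aestronglyMeasurable (.of_forall fun ξ => ?_)
    refine le_of_tendsto (tendsto_fourier_conv_bump hf hη ξ).norm (.of_forall fun n => ?_)
    exact norm_fourier_le_of_support (by positivity) (hFs n) (fun y hy => hF0 n y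
      (lt_of_le_of_lt (by linarith [rOut_shrinkingBump_le n]) hy)) hN0 (hFN n) ξ
  refine ⟨hInt, fun x => ?_⟩
  have hlim : Tendsto (fun n => C * min 1 ((1 + t)⁻¹ * (R + (shrinkingBump n).rOut)) * N) atTop
      (𝓝 (C * min 1 ((1 + t)⁻¹ * R) * N)) := by
    have : Tendsto (fun n => R + (shrinkingBump n).rOut) atTop (𝓝 R) := by
      simpa using hη.const_add R
    exact ((tendsto_const_nhds.min (this.const_mul _)).const_mul _).mul_const _
  constructor
  · exact le_of_tendsto_of_tendsto (tendsto_radialMultiplier_conv_bump hf hInt hη (by fun_prop)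
      (fun r => abs_sin_mul_div_le ht.le r) x).norm hlim (.of_forall fun n =>
        (hsmooth _ t _ N (hrpos n) ht (hFs n) (hF0 n) hN0 (hFN n) x).1)
  · exact le_of_tendsto_of_tendsto (tendsto_radialMultiplier_conv_bump hf hInt hη (by fun_prop)
      (fun r => Real.abs_cos_le_one _) x).norm hlim (.of_forall fun n =>
        (hsmooth _ t _ N (hrpos n) ht (hFs n) (hF0 n) hN0 (hFN n) x).2)

/-- The earlier bounds require $N>0$; using every $N>S$ and letting $N\downarrow S$ covers $S=0$ as
well. -/
theorem eLpNorm_top_le_of_forall_gt {u : E3 → ℂ} {K : NNReal} {μ : ℝ} (hμ : 0 ≤ μ) {S T : ℝ≥0∞}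
    (hS : S ≠ ∞) (hST : S ≤ T) (h : ∀ N, S.toReal < N → ∀ x, ‖u x‖ ≤ K * μ * N) :
    eLpNorm u ∞ volume ≤ K * ENNReal.ofReal μ * T := by
  have hpt : ∀ x, ‖u x‖ ≤ K * μ * S.toReal := by
    intro x
    have hlim : Tendsto (fun N : ℝ => K * μ * N) (𝓝[>] S.toReal) (𝓝 (K * μ * S.toReal)) :=
      ((continuous_const.mul continuous_id).tendsto _).mono_left nhdsWithin_le_nhds
    refine ge_of_tendsto hlim ?_
    filter_upwards [self_mem_nhdsWithin] with N hN
    exact h N hN x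
  rw [eLpNorm_exponent_top]
  refine (eLpNormEssSup_le_of_ae_bound (.of_forall hpt)).trans ?_
  rw [ENNReal.ofReal_mul (by positivity), ENNReal.ofReal_mul (by positivity),
    ENNReal.ofReal_toReal hS, ENNReal.ofReal_coe_nnreal]
  gcongr

end Wave3D

end

/-! ### Conclusion -/

theorem lemma3p2 :
    ∃ C : NNReal, ∀ (R t : ℝ) (f : Wave3D.E3 → ℂ), 0 < R → 0 < t →
      Wave3D.MemH 4 f →
      (∀ᵐ x ∂(volume : Measure Wave3D.E3), x ∉ Metric.closedBall (0 : Wave3D.E3) R → f x = 0) →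
      -- the integrals that define the two operators converge absolutely
      Integrable f ∧ Integrable (𝓕 f) ∧
      eLpNorm (Wave3D.waveSin t f) ∞ volume ≤
        C * ENNReal.ofReal (min 1 ((1 + t)⁻¹ * R)) *
          Wave3D.sobolevNorm 4 (Metric.ball (0 : Wave3D.E3) R) f ∧
      eLpNorm (Wave3D.waveCos t f) ∞ volume ≤
        C * ENNReal.ofReal (min 1 ((1 + t)⁻¹ * R)) *
          Wave3D.sobolevNorm 4 (Metric.ball (0 : Wave3D.E3) R) f := by
  obtain ⟨C, hC, hbound⟩ := Wave3D.exists_weak_bound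
  refine ⟨⟨C, hC⟩, fun R t f hR ht hH hsupp => ?_⟩
  -- A finite infimum yields one family of global weak derivatives with finite norm $S$; this $S$ is
  -- later compared with the norm on the ball.
  obtain ⟨g, hg⟩ := iInf_lt_iff.1 hH
  obtain ⟨hw, hfin⟩ := iInf_lt_iff.1 hg
  rw [Measure.restrict_univ] at hfin
  set A := ∑ α ∈ Wave3D.multiIndices 4, eLpNorm (g α) 2 volume ^ 2 with hA
  set S := A ^ (1 / 2 : ℝ) with hSdef
  have hS : S ≠ ∞ := hfin.ne
  have hS2 : S ^ 2 = A := by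
    rw [hSdef, ← ENNReal.rpow_natCast, ← ENNReal.rpow_mul]
    norm_num
  have hf : Integrable f := Wave3D.integrable_of_ae_support
    (locallyIntegrableOn_univ.1 (hw 0 (Wave3D.mem_multiIndices.2 (by simp))).1) hsupp
  have hgS : ∀ α ∈ Wave3D.multiIndices 4, Integrable (fun y => ‖g α y‖ ^ 2) ∧
      ∫ y, ‖g α y‖ ^ 2 ≤ S.toReal ^ 2 := by
    intro α hα
    refine Wave3D.integrable_norm_sq_and_integral_le
      (locallyIntegrableOn_univ.1 (hw α hα).2.1).aestronglyMeasurable hS ?_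
    rw [hS2, hA]
    exact Finset.single_le_sum (f := fun α => eLpNorm (g α) 2 volume ^ 2)
      (fun _ _ => zero_le) hα
  have hmain := fun N (hN : S.toReal < N) => hbound R t f g N hR ht hf hsupp hw
    (ENNReal.toReal_nonneg.trans_lt hN) fun α hα => ⟨(hgS α hα).1, (hgS α hα).2.trans
      (pow_le_pow_left₀ ENNReal.toReal_nonneg hN.le 2)⟩
  have hle := Wave3D.le_sobolevNorm_ball hsupp hw
  have hμ : 0 ≤ min 1 ((1 + t)⁻¹ * R) := le_min zero_le_one (by positivity)
  exact ⟨hf, (hmain (S.toReal + 1) (by linarith)).1,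
    Wave3D.eLpNorm_top_le_of_forall_gt hμ hS hle fun N hN x => ((hmain N hN).2 x).1,
    Wave3D.eLpNorm_top_le_of_forall_gt hμ hS hle fun N hN x => ((hmain N hN).2 x).2⟩
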